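/- Let $d\ge 1$ be an integer, let $r>d+1$ be real, and let $T^d=\{x\in\mathbb R^d: x_i\ge 0,\ x_1+\dots+x_d\le 1\}$. On real polynomials in $d$ variables use the inner product $\langle p,q\rangle=d!\int_{T^d}pq\,dx$. Let $\mathcal V_\ell^d$ be the space of polynomials of degree at most $\ell$ orthogonal to all polynomials of degree less than $\ell$, let $\{P_{\ell,k}\}_{k}$ be an orthonormal basis of $\mathcal V_\ell^d$, and put $P_\ell(x,y)=\sum_k P_{\ell,k}(x)P_{\ell,k}(y)$ (independent of the choice of basis). Let $$M_d=\sup_{\ell\ge1,\;x,y\in T^d}\frac{P_\ell(x,y)}{\ell^{2d}},\qquad c_{d,r}=M_d\sum_{\ell=1}^\infty\frac{\ell^{2d}}{[\ell(\ell+d)]^r}.$$ For $\gamma>0$ let $H_{1,\gamma}$ be the closure of the polynomials (within $L_2(T^d)$, elements being represented by their continuous versions) under the norm $$\|f\|_1^2=\Big(d!\int_{T^d} f\Big)^2+\frac1\gamma\sum_{\ell\ge1}\sum_k[\ell(\ell+d)]^r a_k^\ell(f)^2,\qquad a_k^\ell(f)=d!\int_{T^d} fP_{\ell,k}.$$ Let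 $\gamma_{m,j}$ ($m\ge1$, $1\le j\le m$) be positive weights with $\sup_{m,j}\gamma_{m,j}<\infty$. Let $H_m=H_{1,\gamma_{m,1}}\otimes\cdots\otimes H_{1,\gamma_{m,m}}$ be the Hilbert space tensor product, a space of continuous functions on $(T^d)^m$, with norm $$\|f\|_m^2=\sum_{\boldsymbol\ell,\boldsymbol k}\Big(\prod_{j=1}^m B_{j}(\ell_j)\Big)\Big((d!)^m\int_{(T^d)^m} f(\boldsymbol x)\prod_{j=1}^m P_{\ell_j,k_j}(x_j)\,d\boldsymbol x\Big)^2,$$ where $B_j(0)=1$ and $B_j(\ell)=\gamma_{m,j}^{-1}[\ell(\ell+d)]^r$ for $\ell\ge1$. Let $I_m(f)=(d!)^m\int_{(T^d)^m}f$. For points $\boldsymbol t_1,\dots,\boldsymbol t_n\in(T^d)^m$ let $Q_{n,m}(f)=\frac1n\sum_{i=1}^n f(\boldsymbol t_i)$ (with $Q_{0,m}=0$), let $e_{n,m}=\sup_{\|f\|_m\le1}|I_m(f)-Q_{n,m}(f)|$, and let $e_{0,m}=\sup_{\|f\|_m\le1}|I_m(f)|$. For $\varepsilon\in(0,1)$ let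 $n(\varepsilon,m)$ be the least $n$ for which there are points with $e_{n,m}\le\varepsilon e_{0,m}$. The integration problem is *polynomially tractable* if there are $C,p,q\ge0$ with $$n(\varepsilon,m)\le C\varepsilon^{-p}m^q\qquad\text{for all } m\ge1,\ \varepsilon\in(0,1);$$ the infima of the admissible $p$ and $q$ are the $\varepsilon$-exponent and the $m$-exponent. It is *strongly polynomially tractable* if such a bound holds with $q=0$ (its $\varepsilon$-exponent is then the infimum of $p$ over bounds with $q=0$), and *weakly tractable* if $\lim_{\varepsilon^{-1}+m\to\infty}\frac{\log n(\varepsilon,m)}{\varepsilon^{-1}+m}=0$. Then $M_d<\infty$, $c_{d,r}<\infty$, $n(\varepsilon,m)$ is well defined (finite) for all $m\ge 1$ and $\varepsilon\in(0,1)$, and: 1. Integration is strongly polynomially tractable if and only if $\limsup_{m\to\infty}\sum_{j=1}^m\gamma_{m,j}<\infty$. In that case the $\varepsilon$-exponent of strong polynomial tractability is at most $2$. 2. Integration is polynomially tractable if and only if $\beta:=\limsup_{m\to\infty}\frac{\sum_{j=1}^m\gamma_{m,j}}{\log(m+1)}<\infty$. In that case the $\varepsilon$-exponent is at most $2$ and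 the $m$-exponent is at most $c_{d,r}\beta$; more precisely, for every $q>c_{d,r}\beta$ there is $C\ge 0$ with $n(\varepsilon,m)\le C\varepsilon^{-2}m^{q}$ for all $m\ge1$ and $\varepsilon\in(0,1)$. 3. Integration is weakly tractable if and only if $\lim_{m\to\infty}\frac1m\sum_{j=1}^m\gamma_{m,j}=0$. -/

import Mathlib

open MeasureTheory Filter Topology
open scoped ENNReal

noncomputable section

namespace SimplexQMC

/-- The simplex `T^d ⊆ ℝ^d`; integrals over it (and over its powers `Fin m → simplex d`) are taken
with respect to Lebesgue measure. -/
def simplex (d : ℕ) : Set (Fin d → ℝ) :=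
  {x | (∀ i, 0 ≤ x i) ∧ 0 ≤ 1 - ∑ i, x i}

instance instMeasureSpaceSimplex (d : ℕ) : MeasureSpace (simplex d) :=
  Measure.Subtype.measureSpace

/-! ### Orthonormal polynomials on the simplex -/

/-- The inner product `⟨p, q⟩ = d! ∫_{T^d} p q` on polynomials. Since `vol (T^d) = 1 / d!`,
the factor `d!` is what turns the integral into an average `⨍`. -/
def polyInner {d : ℕ} (p q : MvPolynomial (Fin d) ℝ) : ℝ :=
  ⨍ x : simplex d, MvPolynomial.eval x.1 p * MvPolynomial.eval x.1 q

lemma isClosed_simplex (d : ℕ) : IsClosed (simplex d) := by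
  have : simplex d = (⋂ i, {x : Fin d → ℝ | 0 ≤ x i}) ∩ {x | 0 ≤ 1 - ∑ i, x i} := by
    ext x; simp [simplex]
  rw [this]
  refine (isClosed_iInter fun i => isClosed_le continuous_const (continuous_apply i)).inter ?_
  exact isClosed_le continuous_const (by fun_prop)

lemma isCompact_simplex (d : ℕ) : IsCompact (simplex d) := by
  refine (isCompact_univ_pi fun _ : Fin d => isCompact_Icc (a := (0 : ℝ)) (b := 1)).of_isClosed_subset
    (isClosed_simplex d) ?_
  rintro x ⟨h0, h1⟩ i -
  have := Finset.single_le_sum (f := x) (fun j _ => h0 j) (Finset.mem_univ i)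
  exact ⟨h0 i, by linarith⟩

instance instCompactSpaceSimplex (d : ℕ) : CompactSpace (simplex d) :=
  isCompact_iff_compactSpace.mp (isCompact_simplex d)

instance instIsFiniteMeasureSimplex (d : ℕ) :
    IsFiniteMeasure (volume : Measure (simplex d)) := by
  refine ⟨?_⟩
  rw [Measure.Subtype.volume_univ (isClosed_simplex d).measurableSet.nullMeasurableSet]
  exact (isCompact_simplex d).measure_lt_top

lemma openCube_subset_simplex (d : ℕ) :
    Set.pi Set.univ (fun _ : Fin d => Set.Ioo (0 : ℝ) (1 / (d + 1))) ⊆ simplex d := by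
  intro x hx
  have hx' : ∀ i, 0 < x i ∧ x i < 1 / ((d : ℝ) + 1) := fun i => hx i (Set.mem_univ i)
  refine ⟨fun i => (hx' i).1.le, ?_⟩
  have h1 : ∑ i, x i ≤ ∑ _i : Fin d, 1 / ((d : ℝ) + 1) :=
    Finset.sum_le_sum fun i _ => (hx' i).2.le
  have h2 : ∑ _i : Fin d, 1 / ((d : ℝ) + 1) ≤ 1 := by
    simp only [Finset.sum_const, Finset.card_univ, Fintype.card_fin, nsmul_eq_mul]
    rw [mul_one_div, div_le_one (by positivity)]
    linarith
  linarith

instance instNeZeroVolumeSimplex (d : ℕ) : NeZero (volume : Measure (simplex d)) := by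
  refine ⟨fun h => ?_⟩
  have h1 : (volume : Measure (simplex d)) Set.univ = 0 := by rw [h]; rfl
  rw [Measure.Subtype.volume_univ (isClosed_simplex d).measurableSet.nullMeasurableSet] at h1
  have hU : IsOpen (Set.pi Set.univ (fun _ : Fin d => Set.Ioo (0 : ℝ) (1 / (d + 1)))) :=
    isOpen_set_pi Set.finite_univ fun _ _ => isOpen_Ioo
  have hne : (Set.pi Set.univ (fun _ : Fin d => Set.Ioo (0 : ℝ) (1 / (d + 1)))).Nonempty :=
    Set.univ_pi_nonempty_iff.2 fun _ => Set.nonempty_Ioo.2 (by positivity)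
  exact (hU.measure_pos volume hne).ne' (measure_mono_null (openCube_subset_simplex d) h1)

lemma continuous_evalOn {d : ℕ} (p : MvPolynomial (Fin d) ℝ) :
    Continuous fun x : simplex d => MvPolynomial.eval x.1 p :=
  (MvPolynomial.continuous_eval p).comp continuous_subtype_val

lemma integrable_evalOn_mul {d : ℕ} (p q : MvPolynomial (Fin d) ℝ) :
    Integrable fun x : simplex d => MvPolynomial.eval x.1 p * MvPolynomial.eval x.1 q :=
  ((continuous_evalOn p).mul (continuous_evalOn q)).integrable_of_hasCompactSupport
    (HasCompactSupport.of_compactSpace _)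

lemma polyInner_comm {d : ℕ} (p q : MvPolynomial (Fin d) ℝ) : polyInner p q = polyInner q p := by
  simp only [polyInner, mul_comm]

lemma polyInner_add_left {d : ℕ} (p q s : MvPolynomial (Fin d) ℝ) :
    polyInner (p + q) s = polyInner p s + polyInner q s := by
  simp only [polyInner, average_eq, map_add, add_mul]
  rw [integral_add (integrable_evalOn_mul p s) (integrable_evalOn_mul q s), smul_add]

lemma polyInner_smul_left {d : ℕ} (a : ℝ) (p q : MvPolynomial (Fin d) ℝ) :
    polyInner (a • p) q = a * polyInner p q := by
  simp only [polyInner, average_eq, MvPolynomial.smul_eval, mul_assoc, integral_const_mul,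
    smul_eq_mul]
  ring

lemma polyInner_self_nonneg {d : ℕ} (p : MvPolynomial (Fin d) ℝ) : 0 ≤ polyInner p p := by
  simp only [polyInner, average_eq, smul_eq_mul]
  exact mul_nonneg (by positivity) (integral_nonneg fun x => mul_self_nonneg _)

lemma eq_zero_of_polyInner_self {d : ℕ} (p : MvPolynomial (Fin d) ℝ)
    (h : polyInner p p = 0) : p = 0 := by
  have hint : ∫ x : simplex d, MvPolynomial.eval x.1 p * MvPolynomial.eval x.1 p = 0 := by
    simp only [polyInner, average_eq, smul_eq_mul] at h
    rcases mul_eq_zero.mp h with h | h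
    · exact absurd h (inv_ne_zero (by simpa [measureReal_eq_zero_iff] using NeZero.ne _))
    · exact h
  have hm := (isClosed_simplex d).measurableSet
  have hint' : ∫ x in simplex d, MvPolynomial.eval x p * MvPolynomial.eval x p = 0 := by
    rw [← integral_subtype hm]; exact hint
  have hcont : Continuous fun x : Fin d → ℝ =>
      MvPolynomial.eval x p * MvPolynomial.eval x p :=
    (MvPolynomial.continuous_eval p).mul (MvPolynomial.continuous_eval p)
  have hae := (setIntegral_eq_zero_iff_of_nonneg_ae (.of_forall fun x => mul_self_nonneg _)
    (hcont.continuousOn.integrableOn_compact (isCompact_simplex d))).mp hint'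
  have hU : IsOpen (Set.pi Set.univ (fun _ : Fin d => Set.Ioo (0 : ℝ) (1 / (d + 1)))) :=
    isOpen_set_pi Set.finite_univ fun _ _ => isOpen_Ioo
  have hae' := ae_restrict_of_ae_restrict_of_subset (openCube_subset_simplex d) hae
  have heq := Measure.eqOn_open_of_ae_eq hae' hU hcont.continuousOn continuousOn_const
  refine MvPolynomial.funext_set (fun _ : Fin d => Set.Ioo (0 : ℝ) (1 / (d + 1)))
    (fun _ => Set.Ioo_infinite (by positivity)) fun x hx => ?_
  have := heq hx
  simpa using this

/-- The space `V_ℓ^d` of orthogonal polynomials of degree `ℓ`: the polynomials of degree at most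
`ℓ` that are orthogonal to all polynomials of smaller degree. -/
def orthoSpace (d ℓ : ℕ) : Submodule ℝ (MvPolynomial (Fin d) ℝ) where
  carrier := {p | p.totalDegree ≤ ℓ ∧ ∀ q, q.totalDegree < ℓ → polyInner p q = 0}
  zero_mem' := ⟨by simp, fun q _ => by simp [polyInner, average_eq]⟩
  add_mem' := fun {a b} ha hb =>
    ⟨(MvPolynomial.totalDegree_add a b).trans (max_le ha.1 hb.1), fun q hq => by
      rw [polyInner_add_left, ha.2 q hq, hb.2 q hq, add_zero]⟩
  smul_mem' := fun c p hp =>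
    ⟨(MvPolynomial.totalDegree_smul_le c p).trans hp.1, fun q hq => by
      rw [polyInner_smul_left, hp.2 q hq, mul_zero]⟩

instance instFiniteOrthoSpace (d ℓ : ℕ) : Module.Finite ℝ (orthoSpace d ℓ) :=
  Submodule.finiteDimensional_of_le
    (S₂ := MvPolynomial.restrictTotalDegree (Fin d) ℝ ℓ) fun _ hp =>
      (MvPolynomial.mem_restrictTotalDegree _ _ _).2 hp.1

/-- `V_ℓ^d` as an inner product space with the `L_2(T^d)` inner product. -/
@[reducible]
def orthoCore (d ℓ : ℕ) : InnerProductSpace.Core ℝ (orthoSpace d ℓ) where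
  inner p q := polyInner p.1 q.1
  conj_inner_symm p q := by simpa using polyInner_comm q.1 p.1
  re_inner_nonneg p := by simpa using polyInner_self_nonneg p.1
  add_left p q s := polyInner_add_left p.1 q.1 s.1
  smul_left p q a := by simpa using polyInner_smul_left a p.1 q.1
  definite p h := Subtype.ext (eq_zero_of_polyInner_self p.1 h)

instance instNormedOrthoSpace (d ℓ : ℕ) : NormedAddCommGroup (orthoSpace d ℓ) :=
  (orthoCore d ℓ).toNormedAddCommGroup

instance instInnerOrthoSpace (d ℓ : ℕ) : InnerProductSpace ℝ (orthoSpace d ℓ) :=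
  InnerProductSpace.ofCore (orthoCore d ℓ).toCore

/-- The orthonormal basis `P_{ℓ,k}` of `V_ℓ^d`, `k` ranging over `dim V_ℓ^d` values. -/
def orthoPoly (d ℓ : ℕ) (k : Fin (Module.finrank ℝ (orthoSpace d ℓ))) :
    MvPolynomial (Fin d) ℝ :=
  (stdOrthonormalBasis ℝ (orthoSpace d ℓ) k).1

/-- `P_ℓ(x, y) = ∑_k P_{ℓ,k}(x) P_{ℓ,k}(y)`; it does not depend on the choice of the basis. -/
def projKernel (d ℓ : ℕ) (x y : simplex d) : ℝ :=
  ∑ k, MvPolynomial.eval x.1 (orthoPoly d ℓ k) * MvPolynomial.eval y.1 (orthoPoly d ℓ k)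

/-! ### The Sobolev spaces -/

/-- The indices `(ℓ, k)` of the orthonormal polynomials. -/
abbrev Idx (d : ℕ) : Type := Σ ℓ : ℕ, Fin (Module.finrank ℝ (orthoSpace d ℓ))

/-- The Fourier coefficient `a^ℓ_k(f) = d! ∫_{T^d} f P_{ℓ,k}`. -/
def coeff₁ {d : ℕ} (f : C(simplex d, ℝ)) (i : Idx d) : ℝ :=
  ⨍ x : simplex d, f x * MvPolynomial.eval x.1 (orthoPoly d i.1 i.2)

/-- The squared norm `‖f‖₁² = I₁(f)² + γ⁻¹ ‖(-∇)^{r/2} f‖²_{L₂}`, where `(-∇)^{r/2}` multiplies the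
coefficients of degree `ℓ` by `[ℓ(ℓ+d)]^{r/2}`; the value is `∞` if `f` has no finite norm. -/
def normSq₁ {d : ℕ} (r γ : ℝ) (f : C(simplex d, ℝ)) : ℝ≥0∞ :=
  ENNReal.ofReal ((⨍ x, f x) ^ 2) +
    ENNReal.ofReal (1 / γ) *
      ∑' i : Idx d, ENNReal.ofReal
        (((((i.1 : ℝ) * (i.1 + d)) ^ (r / 2)) * coeff₁ f i) ^ 2)

/-- A polynomial as a continuous function on the simplex. -/
def polyFun {d : ℕ} (p : MvPolynomial (Fin d) ℝ) : C(simplex d, ℝ) :=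
  ⟨fun x => MvPolynomial.eval x.1 p, continuous_evalOn p⟩

/-- `f ∈ H_{1,γ}^{(d,r)}`: `f` is in the closure of the polynomials with respect to `‖·‖₁`.
Elements are represented by their continuous versions. -/
def MemH₁ {d : ℕ} (r γ : ℝ) (f : C(simplex d, ℝ)) : Prop :=
  ∀ δ : ℝ≥0∞, 0 < δ → ∃ p : MvPolynomial (Fin d) ℝ, normSq₁ r γ (f - polyFun p) < δ

/-- The weight `B_{d,r,γ}(ℓ)`. -/
def weightB (d : ℕ) (r γ : ℝ) (ℓ : ℕ) : ℝ :=
  if ℓ = 0 then 1 else 1 / γ * ((ℓ : ℝ) * (ℓ + d)) ^ r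

/-- The Fourier coefficient `(d!)^m ∫_{(T^d)^m} f(x) ∏_j P_{ℓ_j,k_j}(x_j) dx`. -/
def coeff {d m : ℕ} (f : C(Fin m → simplex d, ℝ)) (i : Fin m → Idx d) : ℝ :=
  ⨍ x : Fin m → simplex d,
    f x * ∏ j, MvPolynomial.eval (x j).1 (orthoPoly d (i j).1 (i j).2)

/-- The squared norm `‖f‖_m² = ⟨f, f⟩_m`, with value `∞` if the series diverges. -/
def normSq {d m : ℕ} (r : ℝ) (γ : Fin m → ℝ) (f : C(Fin m → simplex d, ℝ)) : ℝ≥0∞ :=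
  ∑' i : Fin m → Idx d,
    ENNReal.ofReal ((∏ j, weightB d r (γ j) (i j).1) * coeff f i ^ 2)

/-- The function `x ↦ f_1(x_1) ⋯ f_m(x_m)`. -/
def tensorFun {d m : ℕ} (f : Fin m → C(simplex d, ℝ)) : C(Fin m → simplex d, ℝ) :=
  ⟨fun x => ∏ j, f j (x j), by fun_prop⟩

/-- `f ∈ H_m`, the Hilbert space tensor product of the `H_{1,γ_j}`: `f` is in the closure, with
respect to `‖·‖_m`, of the linear span of the products `f_1 ⊗ ⋯ ⊗ f_m` with `f_j ∈ H_{1,γ_j}`. -/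
def MemH {d m : ℕ} (r : ℝ) (γ : Fin m → ℝ) (f : C(Fin m → simplex d, ℝ)) : Prop :=
  ∀ δ : ℝ≥0∞, 0 < δ →
    ∃ g ∈ Submodule.span ℝ (tensorFun '' {h | ∀ j, MemH₁ (d := d) r (γ j) (h j)}),
      normSq r γ (f - g) < δ

/-! ### QMC integration -/

/-- The normalised integral `I_m`. -/
def integ {d m : ℕ} (f : C(Fin m → simplex d, ℝ)) : ℝ := ⨍ x, f x

/-- The QMC rule; it is `0` for `n = 0`. -/
def qmc {d m n : ℕ} (t : Fin n → Fin m → simplex d) (f : C(Fin m → simplex d, ℝ)) : ℝ :=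
  1 / (n : ℝ) * ∑ i, f (t i)

/-- The worst-case error of the QMC rule with points `t` over the unit ball of `H_m`. -/
def wce {d m n : ℕ} (r : ℝ) (γ : Fin m → ℝ) (t : Fin n → Fin m → simplex d) : ℝ≥0∞ :=
  ⨆ (f : C(Fin m → simplex d, ℝ)) (_ : MemH r γ f) (_ : normSq r γ f ≤ 1),
    ENNReal.ofReal |integ f - qmc t f|

/-- The initial error `e_{0,m}`. -/
def initErr (d : ℕ) {m : ℕ} (r : ℝ) (γ : Fin m → ℝ) : ℝ≥0∞ :=
  ⨆ (f : C(Fin m → simplex d, ℝ)) (_ : MemH r γ f) (_ : normSq r γ f ≤ 1),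
    ENNReal.ofReal |integ f|

/-- Some `n`-point QMC rule reduces the initial error by the factor `ε`. -/
def Reduces (d : ℕ) (r : ℝ) (γ : (m : ℕ) → Fin m → ℝ) (ε : ℝ) (m n : ℕ) : Prop :=
  ∃ t : Fin n → Fin m → simplex d,
    wce r (γ m) t ≤ ENNReal.ofReal ε * initErr d r (γ m)

/-- `n(ε, m)`, the least such `n`. -/
def minPoints (d : ℕ) (r : ℝ) (γ : (m : ℕ) → Fin m → ℝ) (ε : ℝ) (m : ℕ) : ℕ :=
  sInf {n | Reduces d r γ ε m n}

/-! ### Tractability -/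

/-- `n(ε, m) ≤ C ε^{-p} m^q` for all `m ≥ 1` and `ε ∈ (0, 1)`. -/
def PolyBound (d : ℕ) (r : ℝ) (γ : (m : ℕ) → Fin m → ℝ) (C p q : ℝ) : Prop :=
  ∀ m : ℕ, 1 ≤ m → ∀ ε ∈ Set.Ioo (0 : ℝ) 1,
    (minPoints d r γ ε m : ℝ) ≤ C * ε ^ (-p) * (m : ℝ) ^ q

def PolyTractable (d : ℕ) (r : ℝ) (γ : (m : ℕ) → Fin m → ℝ) : Prop :=
  ∃ C p q : ℝ, 0 ≤ C ∧ 0 ≤ p ∧ 0 ≤ q ∧ PolyBound d r γ C p q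

def StronglyPolyTractable (d : ℕ) (r : ℝ) (γ : (m : ℕ) → Fin m → ℝ) : Prop :=
  ∃ C p : ℝ, 0 ≤ C ∧ 0 ≤ p ∧ PolyBound d r γ C p 0

/-- The limit is taken over the pairs `(ε, m)` with `ε ∈ (0, 1)` and `m ≥ 1`. -/
def WeaklyTractable (d : ℕ) (r : ℝ) (γ : (m : ℕ) → Fin m → ℝ) : Prop :=
  Tendsto (fun z : ℝ × ℕ => Real.log (minPoints d r γ z.1 z.2) / (z.1⁻¹ + z.2))
    (comap (fun z : ℝ × ℕ => z.1⁻¹ + z.2) atTop ⊓ 𝓟 {z | z.1 ∈ Set.Ioo (0 : ℝ) 1 ∧ 1 ≤ z.2})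
    (𝓝 0)

/-- The `ε`-exponent of strong polynomial tractability. -/
def strongEpsExponent (d : ℕ) (r : ℝ) (γ : (m : ℕ) → Fin m → ℝ) : ℝ :=
  sInf {p | 0 ≤ p ∧ ∃ C : ℝ, 0 ≤ C ∧ PolyBound d r γ C p 0}

/-- The `ε`-exponent of polynomial tractability. -/
def epsExponent (d : ℕ) (r : ℝ) (γ : (m : ℕ) → Fin m → ℝ) : ℝ :=
  sInf {p | 0 ≤ p ∧ ∃ C q : ℝ, 0 ≤ C ∧ 0 ≤ q ∧ PolyBound d r γ C p q}

/-- The `m`-exponent of polynomial tractability. -/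
def mExponent (d : ℕ) (r : ℝ) (γ : (m : ℕ) → Fin m → ℝ) : ℝ :=
  sInf {q | 0 ≤ q ∧ ∃ C p : ℝ, 0 ≤ C ∧ 0 ≤ p ∧ PolyBound d r γ C p q}

/-! ### The constant `c_{d,r}` -/

/-- The numbers `P_ℓ(x, y) / ℓ^{2d}`, `ℓ ≥ 1`, `x, y ∈ T^d`. -/
def kernelRatios (d : ℕ) : Set ℝ :=
  {v | ∃ ℓ : ℕ, 1 ≤ ℓ ∧ ∃ x y : simplex d, v = projKernel d ℓ x y / (ℓ : ℝ) ^ (2 * d)}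

/-- The least constant `M`, depending only on `d`, with `P_ℓ(x, y) ≤ M ℓ^{2d}` for all `ℓ ≥ 1`. -/
def constM (d : ℕ) : ℝ := sSup (kernelRatios d)

/-- The terms `ℓ^{2d} / [ℓ(ℓ+d)]^r`, `ℓ ≥ 1`. -/
def cTerm (d : ℕ) (r : ℝ) (ℓ : ℕ+) : ℝ :=
  (ℓ : ℝ) ^ (2 * d) / ((ℓ : ℝ) * (ℓ + d)) ^ r

/-- `c_{d,r} = M ∑_{ℓ ≥ 1} ℓ^{2d} / [ℓ(ℓ+d)]^r`. -/
def constC (d : ℕ) (r : ℝ) : ℝ := constM d * ∑' ℓ : ℕ+, cTerm d r ℓ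

end SimplexQMC

end

/-! All three criteria are read off from a two-sided estimate: with some `η > 0` independent of `m`
and `ε`, `exp(η ∑ γ_{m,j}) ≤ 2 n(ε,m)` and `n(ε,m) ≤ 2 ε⁻² exp(c_{d,r} ∑ γ_{m,j})`
(`exists_exp_le_minPoints`, `minPoints_le_exp`).

Upper bound. The reproducing kernel of `H_m` is at most `∏ (1 + c_{d,r} γ_{m,j})` on the diagonal,
and independent uniform points have mean squared worst-case error at most this bound divided by `n`;
suitable points are found one at a time by averaging (`exists_points`). The kernel bound needs
`P_ℓ(x,x) ≤ M ℓ^{2d}` with `M` finite, which is a Nikolskii inequality (`sq_eval_le_polyInner`): by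
Markov's inequality a polynomial of degree at most `ℓ` keeps half of its maximal modulus on the copy
of the simplex shrunk by `1/(8ℓ²)` towards a maximum point, and this copy has volume proportional to
`ℓ^{-2d}`.

Lower bound. The reproducing kernel may take negative values, so it is replaced by the smaller
kernel `∏ (1 + η γ_j (P_1 + P_2))`. For small `η`, uniform in `m` because the weights are bounded,
this kernel is pointwise nonnegative, and `P_1 + P_2 ≥ κ > 0` on the diagonal. Error at most `ε`
forces its double sum over the points to be at most `(1 + ε²) n²` (`sum_lowKernel_le`), whereas the
diagonal terms alone give `n ∏ (1 + η κ γ_j)`. -/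

noncomputable section

namespace SimplexQMC

/-! ### A Nikolskii inequality on the simplex -/

open Polynomial in
/-- Markov's inequality at the left end point of `[s, 1]`. -/
lemma abs_derivative_eval_le {q : ℝ[X]} {ℓ : ℕ} (hq : q.natDegree ≤ ℓ) {B s : ℝ} (hB : 0 < B)
    (hs : 0 ≤ s) (hs1 : s ≤ 1 / 2) (hb : ∀ x ∈ Set.Icc (0 : ℝ) 1, |q.eval x| ≤ B) :
    |q.derivative.eval s| ≤ 4 * ℓ ^ 2 * B := by
  -- The comparison with the Chebyshev polynomial is one-sided; the sign `σ` supplies both sides.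
  have key : ∀ σ : ℝ, |σ| = 1 → σ * q.derivative.eval s ≤ 4 * ℓ ^ 2 * B := by
    intro σ hσ
    -- `L` maps `[-1, 1]` onto `[s, 1]` with orientation reversed and `L(1) = s`, so the extremal
    -- value `T_ℓ'(1) = ℓ²` controls the derivative at `s`.
    set L : ℝ[X] := C (s + (1 - s) / 2) - C ((1 - s) / 2) * X with hL
    have hLdeg : L.natDegree ≤ 1 := by
      rw [hL]; compute_degree
    set P : ℝ[X] := C (-σ / B) * q.comp L with hP
    have hPdeg : P.degree ≤ ℓ := by
      refine (degree_le_natDegree).trans ?_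
      have : P.natDegree ≤ ℓ := by
        refine (natDegree_C_mul_le _ _).trans (natDegree_comp_le.trans ?_)
        calc _ ≤ q.natDegree * 1 := Nat.mul_le_mul_left _ hLdeg
          _ ≤ ℓ := by simpa using hq
      exact_mod_cast this
    have hPb : ∀ x ∈ Set.Icc (-1 : ℝ) 1, |P.eval x| ≤ 1 := by
      intro x hx
      simp only [hP, hL, eval_mul, eval_C, eval_comp, eval_sub, eval_X, abs_mul, abs_div, abs_neg,
        hσ, abs_of_pos hB]
      rw [one_div_mul_eq_div, div_le_one hB]
      apply hb
      constructor <;> nlinarith [hx.1, hx.2]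
    have := Chebyshev.eval_iterate_derivative_le_of_forall_abs_le_one (k := 1) le_rfl hPdeg hPb
    simp only [Function.iterate_one, Chebyshev.T_derivative_eq_U] at this
    simp only [hP, hL, derivative_mul, derivative_C, derivative_comp, derivative_sub, derivative_X,
      eval_mul, eval_C, eval_comp, eval_sub, eval_X, zero_mul, zero_add,
      mul_one, zero_sub, eval_neg, Chebyshev.U_eval_one] at this
    have e : s + (1 - s) / 2 - (1 - s) / 2 = s := by ring
    rw [e] at this
    simp at this
    have h2 : σ * q.derivative.eval s * ((1 - s) / 2) ≤ ℓ ^ 2 * B := by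
      have := mul_le_mul_of_nonneg_right this hB.le
      calc _ = -(-σ / B * ((1 - s) / 2 * eval s (derivative q))) * B := by field_simp
        _ ≤ _ := this
        _ = _ := by ring
    -- The factor 4 comes from `(1 - s) / 2 ≥ 1 / 4`.
    by_cases h0 : σ * q.derivative.eval s ≤ 0
    · exact h0.trans (by positivity)
    · nlinarith
  rw [abs_le]
  constructor
  · have := key (-1) (by simp); linarith
  · have := key 1 (by simp); linarith

open Polynomial in
lemma abs_eval_sub_eval_zero_le {q : ℝ[X]} {ℓ : ℕ} (hq : q.natDegree ≤ ℓ) {B t : ℝ} (hB : 0 < B)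
    (ht : 0 ≤ t) (ht1 : t ≤ 1 / 2) (hb : ∀ x ∈ Set.Icc (0 : ℝ) 1, |q.eval x| ≤ B) :
    |q.eval t - q.eval 0| ≤ 4 * ℓ ^ 2 * B * t := by
  have := (convex_Icc (0 : ℝ) (1 / 2)).norm_image_sub_le_of_norm_deriv_le
    (f := fun x => q.eval x) (C := 4 * ℓ ^ 2 * B) (x := 0) (y := t)
    (fun x _ => q.differentiableAt) (fun x hx => by
      rw [Polynomial.deriv]
      exact abs_derivative_eval_le hq hB hx.1 hx.2 hb) (by constructor <;> norm_num) ⟨ht, ht1⟩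
  simpa [abs_of_nonneg ht] using this

lemma convex_simplex (d : ℕ) : Convex ℝ (simplex d) := by
  intro x hx y hy a b ha hb hab
  refine ⟨fun i => ?_, ?_⟩
  · have h1 := hx.1 i
    have h2 := hy.1 i
    simp only [Pi.add_apply, Pi.smul_apply, smul_eq_mul]
    positivity
  · simp only [Pi.add_apply, Pi.smul_apply, smul_eq_mul, Finset.sum_add_distrib, ← Finset.mul_sum]
    nlinarith [hx.2, hy.2, mul_nonneg ha hx.2, mul_nonneg hb hy.2]

lemma homothety_mem_simplex {d : ℕ} {x y : Fin d → ℝ} (hx : x ∈ simplex d) (hy : y ∈ simplex d)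
    {s : ℝ} (hs : 0 ≤ s) (hs1 : s ≤ 1) : AffineMap.homothety x s y ∈ simplex d := by
  rw [AffineMap.homothety_eq_lineMap]
  exact (convex_simplex d).lineMap_mem hx hy ⟨hs, hs1⟩

lemma measureReal_homothety_simplex {d : ℕ} (x : Fin d → ℝ) {s : ℝ} (hs : 0 ≤ s) :
    volume.real (AffineMap.homothety x s '' simplex d) = s ^ d * volume.real (simplex d) := by
  rw [measureReal_def, Measure.addHaar_image_homothety, ENNReal.toReal_mul, ENNReal.toReal_ofReal
    (abs_nonneg _), abs_of_nonneg (by positivity)]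
  simp [measureReal_def]

lemma measureReal_univ_simplex (d : ℕ) :
    (volume : Measure (simplex d)).real Set.univ = volume.real (simplex d) := by
  rw [measureReal_def, measureReal_def,
    Measure.Subtype.volume_univ (isClosed_simplex d).measurableSet.nullMeasurableSet]

lemma measureReal_simplex_pos (d : ℕ) : 0 < volume.real (simplex d) := by
  rw [← measureReal_univ_simplex]
  exact measureReal_univ_pos

lemma polyInner_eq_setIntegral {d : ℕ} (p q : MvPolynomial (Fin d) ℝ) :
    polyInner p q = (volume.real (simplex d))⁻¹ *
      ∫ x in simplex d, MvPolynomial.eval x p * MvPolynomial.eval x q := by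
  rw [polyInner, average_eq, measureReal_univ_simplex, smul_eq_mul,
    ← integral_subtype (isClosed_simplex d).measurableSet]

/-- Nikolskii's inequality. Restricting `p` to segments issuing from a maximum point `x₀` of `|p|`,
Markov's inequality gives `|p| ≥ B / 2` on the homothetic copy of ratio `s` at `x₀`. That copy
carries the fraction `s ^ d` of the volume, so the mean of `p²` is at least `s ^ d B² / 4`. -/
lemma sq_eval_le_polyInner {d ℓ : ℕ} (hℓ : 1 ≤ ℓ) {p : MvPolynomial (Fin d) ℝ}
    (hp : p.totalDegree ≤ ℓ) {x : Fin d → ℝ} (hx : x ∈ simplex d) :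
    MvPolynomial.eval x p ^ 2 ≤ 4 * (8 * (ℓ : ℝ) ^ 2) ^ d * polyInner p p := by
  obtain ⟨x₀, hx₀, hmax⟩ := (isCompact_simplex d).exists_isMaxOn ⟨x, hx⟩
    (f := fun x => |MvPolynomial.eval x p|) (MvPolynomial.continuous_eval p).abs.continuousOn
  have hmax' : ∀ y ∈ simplex d, |MvPolynomial.eval y p| ≤ |MvPolynomial.eval x₀ p| :=
    fun y hy => hmax hy
  set B := |MvPolynomial.eval x₀ p| with hBdef
  have hxB : MvPolynomial.eval x p ^ 2 ≤ B ^ 2 := by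
    rw [← sq_abs]; gcongr; exact hmax' x hx
  refine hxB.trans ?_
  have hB0 : 0 ≤ B := abs_nonneg _
  rcases hB0.eq_or_lt with hB | hB
  · rw [← hB, zero_pow two_ne_zero]
    exact mul_nonneg (by positivity) (polyInner_self_nonneg p)
  have hℓ' : (1 : ℝ) ≤ ℓ := by exact_mod_cast hℓ
  -- Chosen so that the Markov bound `4 ℓ² B s` on the variation equals `B / 2`.
  set s : ℝ := 1 / (8 * (ℓ : ℝ) ^ 2) with hs
  have hs0 : 0 < s := by positivity
  have hs1 : s ≤ 1 / 2 := by
    rw [hs]; apply one_div_le_one_div_of_le <;> nlinarith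
  have hlow : ∀ y ∈ simplex d, B / 2 ≤ |MvPolynomial.eval (AffineMap.homothety x₀ s y) p| := by
    intro y hy
    set q : Polynomial ℝ := MvPolynomial.aeval
      (fun i => Polynomial.C (x₀ i) + Polynomial.C (y i - x₀ i) * Polynomial.X) p with hq
    have hqe : ∀ t, q.eval t = MvPolynomial.eval (AffineMap.homothety x₀ t y) p := by
      intro t
      rw [hq, ← Polynomial.coe_evalRingHom, MvPolynomial.aeval_def,
        MvPolynomial.hom_eval₂, MvPolynomial.eval, MvPolynomial.coe_eval₂Hom]
      congr 1
      · ext; simp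
      · ext i; simp [AffineMap.homothety_apply]; ring
    have hqd : q.natDegree ≤ ℓ := by
      have := MvPolynomial.aeval_natDegree_le p hp
        (fun i => Polynomial.C (x₀ i) + Polynomial.C (y i - x₀ i) * Polynomial.X) (n := 1)
        (fun i => by compute_degree)
      rwa [mul_one] at this
    have := abs_eval_sub_eval_zero_le hqd hB hs0.le hs1 (fun t ht => by
      rw [hqe]; exact hmax' _ (homothety_mem_simplex hx₀ hy ht.1 ht.2))
    have e : 4 * (ℓ : ℝ) ^ 2 * B * s = B / 2 := by rw [hs]; field_simp; norm_num
    rw [e, hqe, hqe] at this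
    simp only [AffineMap.homothety_zero, AffineMap.const_apply] at this
    have h3 := abs_sub_abs_le_abs_sub (MvPolynomial.eval x₀ p)
      (MvPolynomial.eval (AffineMap.homothety x₀ s y) p)
    rw [abs_sub_comm] at h3
    linarith
  have hsub : AffineMap.homothety x₀ s '' simplex d ⊆ simplex d := by
    rintro _ ⟨y, hy, rfl⟩
    exact homothety_mem_simplex hx₀ hy hs0.le (by linarith)
  have hcont : Continuous fun x : Fin d → ℝ => MvPolynomial.eval x p * MvPolynomial.eval x p :=
    (MvPolynomial.continuous_eval p).mul (MvPolynomial.continuous_eval p)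
  have hcomp : IsCompact (AffineMap.homothety x₀ s '' simplex d) :=
    (isCompact_simplex d).image (AffineMap.continuous_of_finiteDimensional _)
  have hintegral := hcont.continuousOn.integrableOn_compact (μ := volume) (isCompact_simplex d)
  have h1 : B ^ 2 / 4 * (s ^ d * volume.real (simplex d)) ≤
      ∫ x in simplex d, MvPolynomial.eval x p * MvPolynomial.eval x p := by
    calc _ = ∫ x in AffineMap.homothety x₀ s '' simplex d, B ^ 2 / 4 := by
          rw [setIntegral_const, measureReal_homothety_simplex x₀ hs0.le, smul_eq_mul]; ring
      _ ≤ ∫ x in AffineMap.homothety x₀ s '' simplex d,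
            MvPolynomial.eval x p * MvPolynomial.eval x p := by
          refine setIntegral_mono_on (integrableOn_const hcomp.measure_lt_top.ne)
            (hintegral.mono_set hsub) hcomp.measurableSet ?_
          rintro _ ⟨y, hy, rfl⟩
          have := hlow y hy
          rw [← abs_mul_abs_self]
          nlinarith
      _ ≤ _ := setIntegral_mono_set hintegral (.of_forall fun x => mul_self_nonneg _)
          hsub.eventuallyLE
  rw [polyInner_eq_setIntegral]
  have hv := measureReal_simplex_pos d
  have h2 : B ^ 2 / 4 * s ^ d ≤ (volume.real (simplex d))⁻¹ *
      ∫ x in simplex d, MvPolynomial.eval x p * MvPolynomial.eval x p := by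
    rw [inv_mul_eq_div, le_div_iff₀ hv]; linarith
  have h3 : (8 * (ℓ : ℝ) ^ 2) ^ d * s ^ d = 1 := by
    rw [← mul_pow, hs, mul_one_div_cancel (by positivity), one_pow]
  calc B ^ 2 = 4 * (8 * (ℓ : ℝ) ^ 2) ^ d * (B ^ 2 / 4 * s ^ d) := by
        linear_combination -B ^ 2 * h3
    _ ≤ _ := by gcongr

/-! ### The projection kernels and the constants -/

lemma orthoPoly_mem (d ℓ : ℕ) (k) : orthoPoly d ℓ k ∈ orthoSpace d ℓ :=
  (stdOrthonormalBasis ℝ (orthoSpace d ℓ) k).2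

lemma inner_orthoSpace {d ℓ : ℕ} (p q : orthoSpace d ℓ) : inner ℝ p q = polyInner p.1 q.1 := rfl

lemma polyInner_orthoPoly_same {d ℓ : ℕ} (k k' : Fin (Module.finrank ℝ (orthoSpace d ℓ))) :
    polyInner (orthoPoly d ℓ k) (orthoPoly d ℓ k') = if k = k' then 1 else 0 :=
  orthonormal_iff_ite.1 (stdOrthonormalBasis ℝ (orthoSpace d ℓ)).orthonormal k k'

lemma projKernel_self_nonneg {d ℓ : ℕ} (x : simplex d) : 0 ≤ projKernel d ℓ x x :=
  Finset.sum_nonneg fun _ _ => mul_self_nonneg _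

/-- The polynomial `p = P_ℓ(x, ·)` satisfies `p(x) = ‖p‖² = P_ℓ(x,x)`, so Nikolskii's inequality
reads `K² ≤ c K` with `K = P_ℓ(x,x)`. -/
lemma projKernel_self_le {d ℓ : ℕ} (hℓ : 1 ≤ ℓ) (x : simplex d) :
    projKernel d ℓ x x ≤ 4 * 8 ^ d * (ℓ : ℝ) ^ (2 * d) := by
  set b := stdOrthonormalBasis ℝ (orthoSpace d ℓ)
  set p : orthoSpace d ℓ := ∑ k, MvPolynomial.eval x.1 (orthoPoly d ℓ k) • b k with hp
  have h1 : MvPolynomial.eval x.1 p.1 = projKernel d ℓ x x := by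
    simp [hp, projKernel, orthoPoly, b, MvPolynomial.smul_eval]
  have h2 : polyInner p.1 p.1 = projKernel d ℓ x x := by
    rw [← inner_orthoSpace, hp, b.orthonormal.inner_sum]
    simp [projKernel]
  have h3 := sq_eval_le_polyInner hℓ p.2.1 x.2
  rw [h1, h2] at h3
  have e : 4 * (8 * (ℓ : ℝ) ^ 2) ^ d = 4 * 8 ^ d * (ℓ : ℝ) ^ (2 * d) := by
    rw [mul_pow, ← pow_mul]; ring
  rw [e] at h3
  rcases (projKernel_self_nonneg (ℓ := ℓ) x).eq_or_lt with h | h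
  · rw [← h]; positivity
  · nlinarith

lemma projKernel_le_add {d ℓ : ℕ} (x y : simplex d) :
    |projKernel d ℓ x y| ≤ (projKernel d ℓ x x + projKernel d ℓ y y) / 2 := by
  rw [projKernel, projKernel, projKernel, ← Finset.sum_add_distrib, Finset.sum_div]
  refine (Finset.abs_sum_le_sum_abs _ _).trans (Finset.sum_le_sum fun k _ => ?_)
  rw [abs_le]
  constructor <;> nlinarith [sq_nonneg (MvPolynomial.eval x.1 (orthoPoly d ℓ k) -
    MvPolynomial.eval y.1 (orthoPoly d ℓ k)), sq_nonneg (MvPolynomial.eval x.1 (orthoPoly d ℓ k) +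
    MvPolynomial.eval y.1 (orthoPoly d ℓ k))]

lemma abs_projKernel_le {d ℓ : ℕ} (hℓ : 1 ≤ ℓ) (x y : simplex d) :
    |projKernel d ℓ x y| ≤ 4 * 8 ^ d * (ℓ : ℝ) ^ (2 * d) := by
  have := projKernel_le_add (ℓ := ℓ) x y
  have h1 := projKernel_self_le hℓ x
  have h2 := projKernel_self_le hℓ y
  linarith

theorem bddAbove_kernelRatios (d : ℕ) : BddAbove (kernelRatios d) := by
  refine ⟨4 * 8 ^ d, ?_⟩
  rintro _ ⟨ℓ, hℓ, x, y, rfl⟩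
  have : (0 : ℝ) < ℓ := by exact_mod_cast hℓ
  rw [div_le_iff₀ (by positivity)]
  exact (le_abs_self _).trans (abs_projKernel_le hℓ x y)

instance instNonemptySimplex (d : ℕ) : Nonempty (simplex d) :=
  ⟨⟨0, by simp [simplex]⟩⟩

lemma constM_nonneg (d : ℕ) : 0 ≤ constM d := by
  obtain ⟨x⟩ := instNonemptySimplex d
  refine le_csSup_of_le (bddAbove_kernelRatios d) ⟨1, le_rfl, x, x, rfl⟩ ?_
  exact div_nonneg (projKernel_self_nonneg x) (by positivity)

lemma projKernel_self_le_constM {d ℓ : ℕ} (hℓ : 1 ≤ ℓ) (x : simplex d) :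
    projKernel d ℓ x x ≤ constM d * (ℓ : ℝ) ^ (2 * d) := by
  have : (0 : ℝ) < ℓ := by exact_mod_cast hℓ
  rw [← div_le_iff₀ (by positivity)]
  exact le_csSup (bddAbove_kernelRatios d) ⟨ℓ, hℓ, x, x, rfl⟩

lemma cTerm_nonneg (d : ℕ) (r : ℝ) (ℓ : ℕ+) : 0 ≤ cTerm d r ℓ := by
  unfold cTerm; positivity

/-- Since `ℓ (ℓ + d) ≥ ℓ²`, the terms are at most `ℓ ^ (2d - 2r)`, and `2r - 2d > 2`. -/
theorem summable_cTerm {d : ℕ} {r : ℝ} (hr : (d : ℝ) + 1 < r) : Summable (cTerm d r) := by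
  have h1 : Summable fun n : ℕ => (n : ℝ) ^ (2 * (d : ℝ) - 2 * r) :=
    Real.summable_nat_rpow.2 (by linarith)
  have h2 : Summable fun n : ℕ+ => ((n : ℕ) : ℝ) ^ (2 * (d : ℝ) - 2 * r) :=
    h1.comp_injective PNat.coe_injective
  refine h2.of_nonneg_of_le (cTerm_nonneg d r) fun ℓ => ?_
  have hℓ : (0 : ℝ) < (ℓ : ℕ) := by exact_mod_cast ℓ.pos
  have hr0 : 0 ≤ r := by have : (0 : ℝ) ≤ d := by positivity
                         linarith
  rw [cTerm, Real.rpow_sub hℓ]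
  have e1 : ((ℓ : ℕ) : ℝ) ^ (2 * (d : ℝ)) = ((ℓ : ℕ) : ℝ) ^ (2 * d) := by
    rw [← Real.rpow_natCast]; push_cast; rfl
  rw [e1]
  gcongr
  rw [Real.rpow_mul hℓ.le]
  apply Real.rpow_le_rpow (by positivity) _ hr0
  have : (0 : ℝ) ≤ d := by positivity
  norm_num
  nlinarith

lemma constC_nonneg (d : ℕ) (r : ℝ) : 0 ≤ constC d r :=
  mul_nonneg (constM_nonneg d) (tsum_nonneg (cTerm_nonneg d r))

/-! ### The orthonormal polynomials -/

/-- The polynomial `P_{ℓ,k}` with index `i = (ℓ, k)`. -/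
def idxPoly {d : ℕ} (i : Idx d) : MvPolynomial (Fin d) ℝ := orthoPoly d i.1 i.2

lemma polyInner_idxPoly {d : ℕ} (i i' : Idx d) :
    polyInner (idxPoly i) (idxPoly i') = if i = i' then 1 else 0 := by
  obtain ⟨ℓ, k⟩ := i
  obtain ⟨ℓ', k'⟩ := i'
  rcases lt_trichotomy ℓ ℓ' with h | rfl | h
  · rw [if_neg (by rintro ⟨⟩; exact h.ne rfl), polyInner_comm]
    exact (orthoPoly_mem d ℓ' k').2 _ ((orthoPoly_mem d ℓ k).1.trans_lt h)
  · refine (polyInner_orthoPoly_same k k').trans ?_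
    simp
  · rw [if_neg (by rintro ⟨⟩; exact h.ne rfl)]
    exact (orthoPoly_mem d ℓ k).2 _ ((orthoPoly_mem d ℓ' k').1.trans_lt h)

lemma orthoSpace_le_span (d ℓ : ℕ) :
    orthoSpace d ℓ ≤ Submodule.span ℝ (Set.range fun k => orthoPoly d ℓ k) := by
  intro p hp
  have := (stdOrthonormalBasis ℝ (orthoSpace d ℓ)).sum_repr ⟨p, hp⟩
  have h2 := congrArg Subtype.val this
  simp only [Submodule.coe_sum, Submodule.coe_smul] at h2
  rw [← h2]
  exact Submodule.sum_mem _ fun k _ => Submodule.smul_mem _ _ (Submodule.subset_span ⟨k, rfl⟩)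

/-- The inner product of `L_2(T^d)` on all polynomials. -/
@[reducible]
def polyCore (d : ℕ) : InnerProductSpace.Core ℝ (MvPolynomial (Fin d) ℝ) where
  inner p q := polyInner p q
  conj_inner_symm p q := by simpa using polyInner_comm q p
  re_inner_nonneg p := by simpa using polyInner_self_nonneg p
  add_left p q s := polyInner_add_left p q s
  smul_left p q a := by simpa using polyInner_smul_left a p q
  definite p h := eq_zero_of_polyInner_self p h

/-- The inner product structure is installed only locally, in order to use orthogonal projection
onto a finite-dimensional subspace. -/
lemma exists_add_orthogonal {d : ℕ} (U : Submodule ℝ (MvPolynomial (Fin d) ℝ))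
    [Module.Finite ℝ U] (p : MvPolynomial (Fin d) ℝ) :
    ∃ u ∈ U, ∃ v, (∀ q ∈ U, polyInner v q = 0) ∧ p = u + v := by
  let : NormedAddCommGroup (MvPolynomial (Fin d) ℝ) := (polyCore d).toNormedAddCommGroup
  let : InnerProductSpace ℝ (MvPolynomial (Fin d) ℝ) := InnerProductSpace.ofCore (polyCore d).toCore
  obtain ⟨u, hu, v, hv, h⟩ := U.exists_add_mem_mem_orthogonal p
  refine ⟨u, hu, v, fun q hq => ?_, h⟩
  rw [polyInner_comm]
  exact (U.mem_orthogonal v).1 hv q hq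

/-- Induction on the degree: splitting off the projection onto polynomials of degree at most `L - 1`
leaves a remainder in `orthoSpace d L`. -/
lemma mem_span_idxPoly {d L : ℕ} {p : MvPolynomial (Fin d) ℝ} (hp : p.totalDegree ≤ L) :
    p ∈ Submodule.span ℝ (idxPoly '' {i : Idx d | i.1 ≤ L}) := by
  induction L using Nat.strong_induction_on generalizing p with
  | _ L ih =>
    have hV : ∀ v ∈ orthoSpace d L, v ∈ Submodule.span ℝ (idxPoly '' {i : Idx d | i.1 ≤ L}) := by
      intro v hv
      refine Submodule.span_mono ?_ (orthoSpace_le_span d L hv)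
      rintro _ ⟨k, rfl⟩
      exact ⟨⟨L, k⟩, le_refl L, rfl⟩
    rcases Nat.eq_zero_or_pos L with rfl | hL
    · exact hV p ⟨hp, fun q hq => absurd hq (Nat.not_lt_zero _)⟩
    · obtain ⟨u, hu, v, hv, rfl⟩ :=
        exists_add_orthogonal (MvPolynomial.restrictTotalDegree (Fin d) ℝ (L - 1)) p
      rw [MvPolynomial.mem_restrictTotalDegree] at hu
      have hu' := ih (L - 1) (by omega) hu
      refine Submodule.add_mem _ (Submodule.span_mono (Set.image_mono fun i hi => ?_) hu')
        (hV v ⟨?_, fun q hq => hv q ?_⟩)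
      · exact le_trans hi (Nat.sub_le _ _)
      · have : v = (u + v) - u := by ring
        rw [this]
        exact (MvPolynomial.totalDegree_sub _ _).trans (max_le hp (by omega))
      · rw [MvPolynomial.mem_restrictTotalDegree]; omega

lemma orthoSpace_zero_eq_C {d : ℕ} (p : orthoSpace d 0) : ∃ a : ℝ, p.1 = MvPolynomial.C a :=
  ⟨_, MvPolynomial.totalDegree_eq_zero_iff_eq_C.1 (Nat.le_zero.1 p.2.1)⟩

lemma finrank_orthoSpace_zero (d : ℕ) : Module.finrank ℝ (orthoSpace d 0) = 1 := by
  refine finrank_eq_one (⟨1, by simp, fun q hq => absurd hq (Nat.not_lt_zero _)⟩ : orthoSpace d 0)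
    (fun h => one_ne_zero (congrArg Subtype.val h)) fun w => ?_
  obtain ⟨a, ha⟩ := orthoSpace_zero_eq_C w
  exact ⟨a, Subtype.ext (by rw [ha]; simp [MvPolynomial.smul_eq_C_mul])⟩

/-- The index of the constant polynomial. -/
def zeroIdx (d : ℕ) : Idx d := ⟨0, ⟨0, by rw [finrank_orthoSpace_zero]; exact one_pos⟩⟩

lemma eq_zeroIdx {d : ℕ} {i : Idx d} (h : i.1 = 0) : i = zeroIdx d := by
  obtain ⟨ℓ, k, hk⟩ := i
  obtain rfl : ℓ = 0 := h
  have := finrank_orthoSpace_zero d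
  obtain rfl : k = 0 := by omega
  rfl

/-- The basis is an arbitrary choice, so its constant member is determined only up to sign; `a * a =
1` is all that is needed later. -/
lemma exists_idxPoly_zeroIdx (d : ℕ) :
    ∃ a : ℝ, idxPoly (zeroIdx d) = MvPolynomial.C a ∧ a * a = 1 := by
  obtain ⟨a, ha⟩ := orthoSpace_zero_eq_C ⟨_, orthoPoly_mem d 0 (zeroIdx d).2⟩
  refine ⟨a, ha, ?_⟩
  have h := polyInner_idxPoly (zeroIdx d) (zeroIdx d)
  have h2 : idxPoly (zeroIdx d) = MvPolynomial.C a := ha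
  rw [h2, if_pos rfl] at h
  simpa [polyInner] using h

/-! ### The tensor product basis -/

lemma average_prod {d m : ℕ} (f : Fin m → simplex d → ℝ) :
    ⨍ x : Fin m → simplex d, ∏ j, f j (x j) = ∏ j, ⨍ x, f j x := by
  simp only [average_eq, smul_eq_mul, Finset.prod_mul_distrib]
  rw [integral_fintype_prod_volume_eq_prod]
  congr 1
  rw [Finset.prod_inv_distrib, measureReal_def, volume_pi, Measure.pi_univ, ENNReal.toReal_prod]
  rfl

/-- The function `∏_j P_{ℓ_j,k_j}(x_j)`. -/
def tensorBasis {d m : ℕ} (i : Fin m → Idx d) : C(Fin m → simplex d, ℝ) :=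
  tensorFun fun j => polyFun (idxPoly (i j))

lemma tensorBasis_apply {d m : ℕ} (i : Fin m → Idx d) (x : Fin m → simplex d) :
    tensorBasis i x = ∏ j, MvPolynomial.eval (x j).1 (idxPoly (i j)) := rfl

lemma coeff_eq {d m : ℕ} (f : C(Fin m → simplex d, ℝ)) (i : Fin m → Idx d) :
    coeff f i = ⨍ x, f x * tensorBasis i x := rfl

lemma coeff_tensorBasis {d m : ℕ} (i i' : Fin m → Idx d) :
    coeff (tensorBasis i) i' = if i = i' then 1 else 0 := by
  simp only [coeff_eq, tensorBasis_apply, ← Finset.prod_mul_distrib]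
  rw [average_prod fun j x => MvPolynomial.eval x.1 (idxPoly (i j)) *
    MvPolynomial.eval x.1 (idxPoly (i' j))]
  have : ∀ j, ⨍ x : simplex d, MvPolynomial.eval x.1 (idxPoly (i j)) *
      MvPolynomial.eval x.1 (idxPoly (i' j)) = if i j = i' j then 1 else 0 := fun j =>
    polyInner_idxPoly (i j) (i' j)
  simp only [this]
  by_cases h : i = i'
  · simp [h]
  · rw [if_neg h]
    obtain ⟨j, hj⟩ := Function.ne_iff.1 h
    exact Finset.prod_eq_zero (Finset.mem_univ j) (if_neg hj)

lemma integrable_of_continuous {d m : ℕ} {f : (Fin m → simplex d) → ℝ} (hf : Continuous f) :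
    Integrable f :=
  hf.integrable_of_hasCompactSupport (HasCompactSupport.of_compactSpace _)

lemma measureReal_univ_pi_pos (d m : ℕ) :
    0 < (volume : Measure (Fin m → simplex d)).real Set.univ := by
  rw [measureReal_def, volume_pi, Measure.pi_univ, ENNReal.toReal_prod]
  exact Finset.prod_pos fun _ _ => measureReal_univ_pos

/-- The functional `f ↦ ⨍ f g` on the continuous functions. -/
def averageMulCLM {d m : ℕ} (g : C(Fin m → simplex d, ℝ)) : C(Fin m → simplex d, ℝ) →L[ℝ] ℝ :=
  LinearMap.mkContinuous
    { toFun := fun f => ⨍ x, f x * g x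
      map_add' := fun f f' => by
        simp only [ContinuousMap.add_apply, add_mul, average_eq]
        rw [integral_add (integrable_of_continuous (by fun_prop))
          (integrable_of_continuous (by fun_prop)), smul_add]
      map_smul' := fun c f => by
        simp only [ContinuousMap.smul_apply, smul_eq_mul, mul_assoc, average_eq,
          integral_const_mul, RingHom.id_apply]
        ring } ‖g‖ fun f => by
    simp only [LinearMap.coe_mk, AddHom.coe_mk]
    rw [average_eq, smul_eq_mul, norm_mul, norm_inv, Real.norm_of_nonneg measureReal_nonneg]
    have h : ‖∫ x, f x * g x‖ ≤
        ‖g‖ * ‖f‖ * (volume : Measure (Fin m → simplex d)).real Set.univ := by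
      refine norm_integral_le_of_norm_le_const (.of_forall fun x => ?_)
      rw [norm_mul, mul_comm]
      exact mul_le_mul (g.norm_coe_le_norm x) (f.norm_coe_le_norm x) (norm_nonneg _) (norm_nonneg _)
    rw [inv_mul_le_iff₀ (measureReal_univ_pi_pos d m)]
    linarith

lemma averageMulCLM_apply {d m : ℕ} (g f : C(Fin m → simplex d, ℝ)) :
    averageMulCLM g f = ⨍ x, f x * g x := rfl

lemma coeff_eq_averageMulCLM {d m : ℕ} (f : C(Fin m → simplex d, ℝ)) (i : Fin m → Idx d) :
    coeff f i = averageMulCLM (tensorBasis i) f := rfl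

lemma averageMulCLM_comm {d m : ℕ} (g f : C(Fin m → simplex d, ℝ)) :
    averageMulCLM g f = averageMulCLM f g := by
  simp only [averageMulCLM_apply, mul_comm]

/-- A relatively open set containing `x` contains a small homothetic copy of the simplex with centre
`x`. This also covers boundary points. -/
instance instIsOpenPosMeasureSimplex (d : ℕ) :
    (volume : Measure (simplex d)).IsOpenPosMeasure := by
  refine ⟨fun U hU ⟨x, hx⟩ h0 => ?_⟩
  obtain ⟨V, hV, rfl⟩ := isOpen_induced_iff.1 hU
  rw [Measure.Subtype.volume_def, comap_subtype_coe_apply (isClosed_simplex d).measurableSet,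
    Subtype.image_preimage_coe] at h0
  have hb : Bornology.IsBounded (simplex d) := (isCompact_simplex d).isBounded
  have ht : Tendsto (fun s : ℝ => s) (𝓝[>] 0) (𝓝 0) := tendsto_id.mono_left nhdsWithin_le_nhds
  have hev : ∀ᶠ s : ℝ in 𝓝[>] 0, AffineMap.homothety x.1 s '' simplex d ⊆ V := by
    obtain ⟨R, hR⟩ := hb.exists_norm_le
    obtain ⟨δ, hδ, hball⟩ := Metric.isOpen_iff.1 hV x.1 hx
    have hlt : ∀ᶠ s : ℝ in 𝓝[>] 0, s * (2 * |R| + 1) < δ := by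
      have : Tendsto (fun s : ℝ => s * (2 * |R| + 1)) (𝓝[>] 0) (𝓝 (0 * (2 * |R| + 1))) :=
        ht.mul_const _
      rw [zero_mul] at this
      exact this.eventually (gt_mem_nhds hδ)
    filter_upwards [hlt, self_mem_nhdsWithin] with s hs hs0
    rintro _ ⟨y, hy, rfl⟩
    apply hball
    rw [Metric.mem_ball, dist_homothety_center, dist_eq_norm, Real.norm_of_nonneg (le_of_lt hs0)]
    refine lt_of_le_of_lt ?_ hs
    have hs0' : (0 : ℝ) < s := hs0
    gcongr
    have h1 := hR _ x.2
    have h2 := hR _ hy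
    have h3 := norm_sub_le x.1 y
    have h4 := le_abs_self R
    linarith
  have hev1 : ∀ᶠ s : ℝ in 𝓝[>] 0, s < 1 := ht.eventually (gt_mem_nhds one_pos)
  obtain ⟨s, ⟨hs, hs1⟩, hs0⟩ := ((hev.and hev1).and self_mem_nhdsWithin).exists
  have hs0' : (0 : ℝ) < s := hs0
  have hnull : volume (AffineMap.homothety x.1 s '' simplex d) = 0 := by
    refine measure_mono_null (Set.subset_inter ?_ hs) h0
    rintro _ ⟨y, hy, rfl⟩
    exact homothety_mem_simplex x.2 hy hs0'.le hs1.le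
  have := measureReal_homothety_simplex x.1 hs0'.le
  rw [measureReal_def, hnull] at this
  have h2 := measureReal_simplex_pos d
  have h3 : 0 < s ^ d * volume.real (simplex d) := by positivity
  simp at this
  rcases this with h | h
  · exact absurd h.1 hs0'.ne'
  · exact absurd h h2.ne'

instance instIsOpenPosMeasurePi (d m : ℕ) :
    (volume : Measure (Fin m → simplex d)).IsOpenPosMeasure := by
  rw [volume_pi]; exact Measure.pi.isOpenPosMeasure _

/-- Each factor is a finite combination of the orthonormal polynomials; multiplying out gives a
finite combination of tensor basis functions. -/
lemma averageMulCLM_tensorFun_eq_zero {d m : ℕ} {f : C(Fin m → simplex d, ℝ)}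
    (hf : ∀ i, coeff f i = 0) (p : Fin m → MvPolynomial (Fin d) ℝ) :
    averageMulCLM f (tensorFun fun j => polyFun (p j)) = 0 := by
  have h : ∀ j, ∃ (F : Finset (Idx d)) (c : Idx d → ℝ), p j = ∑ i ∈ F, c i • idxPoly i := by
    intro j
    have := Submodule.span_mono (Set.image_subset_range _ _)
      (mem_span_idxPoly (le_refl (p j).totalDegree))
    rw [← Set.image_univ, Submodule.mem_span_image_iff_exists_fun] at this
    obtain ⟨t, _, c, hc⟩ := this
    classical
    refine ⟨t, fun i => if h : i ∈ t then c ⟨i, h⟩ else 0, ?_⟩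
    rw [← hc, ← Finset.sum_attach t]
    simp
  choose F c hp using h
  have e : (tensorFun fun j => polyFun (p j)) =
      ∑ i ∈ Fintype.piFinset F, (∏ j, c j (i j)) • tensorBasis i := by
    ext x
    simp only [tensorFun, polyFun, ContinuousMap.coe_mk, ContinuousMap.sum_apply,
      ContinuousMap.smul_apply, smul_eq_mul, tensorBasis_apply, ← Finset.prod_mul_distrib]
    rw [← Finset.prod_univ_sum F fun j i => c j i * MvPolynomial.eval (x j).1 (idxPoly i)]
    refine Finset.prod_congr rfl fun j _ => ?_
    rw [hp j]
    simp [MvPolynomial.smul_eval]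
  rw [e, map_sum]
  refine Finset.sum_eq_zero fun i _ => ?_
  rw [map_smul, averageMulCLM_comm, ← coeff_eq_averageMulCLM, hf, smul_zero]

/-- The coordinate `x ↦ x_{j,a}` on `(T^d)^m`. -/
def coordFun {d m : ℕ} (v : Fin m × Fin d) : C(Fin m → simplex d, ℝ) :=
  ⟨fun x => (x v.1).1 v.2,
    (continuous_apply v.2).comp (continuous_subtype_val.comp (continuous_apply v.1))⟩

lemma aeval_coordFun_monomial {d m : ℕ} (s : Fin m × Fin d →₀ ℕ) (a : ℝ) :
    MvPolynomial.aeval (coordFun (d := d) (m := m)) (MvPolynomial.monomial s a) =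
      a • tensorFun fun j => polyFun (∏ b, MvPolynomial.X b ^ s (j, b)) := by
  ext x
  rw [MvPolynomial.aeval_monomial, Finsupp.prod_fintype _ _ (by simp), Fintype.prod_prod_type]
  simp [tensorFun, polyFun, coordFun]

/-- A continuous function is determined by its Fourier coefficients. -/
theorem eq_zero_of_coeff_eq_zero {d m : ℕ} {f : C(Fin m → simplex d, ℝ)}
    (hf : ∀ i, coeff f i = 0) : f = 0 := by
  -- By Stone–Weierstrass `f` is a uniform limit of polynomials. These are all orthogonal to `f`, so
  -- the mean of `f²` vanishes, and the measure charges open sets.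
  set A : Subalgebra ℝ C(Fin m → simplex d, ℝ) :=
    (MvPolynomial.aeval (R := ℝ) (coordFun (d := d) (m := m))).range with hA
  have hsep : A.SeparatesPoints := by
    intro x y hxy
    obtain ⟨j, hj⟩ := Function.ne_iff.1 hxy
    obtain ⟨b, hb⟩ := Function.ne_iff.1 (fun h => hj (Subtype.ext h) : (x j).1 ≠ (y j).1)
    exact ⟨_, ⟨coordFun (j, b), ⟨MvPolynomial.X (j, b), by simp⟩, rfl⟩, hb⟩
  have hmem := ContinuousMap.continuousMap_mem_subalgebra_closure_of_separatesPoints A hsep f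
  have hzero : ∀ g ∈ A, averageMulCLM f g = 0 := by
    rintro _ ⟨P, rfl⟩
    simp only [AlgHom.toRingHom_eq_coe, RingHom.coe_coe]
    induction P using MvPolynomial.induction_on' with
    | monomial s a =>
      rw [aeval_coordFun_monomial, map_smul, averageMulCLM_tensorFun_eq_zero hf, smul_zero]
    | add p q hp hq => rw [map_add, map_add, hp, hq, add_zero]
  have hcl : averageMulCLM f f = 0 := by
    have : (A.topologicalClosure : Set C(Fin m → simplex d, ℝ)) ⊆
        {g | averageMulCLM f g = 0} := by
      rw [Subalgebra.topologicalClosure_coe]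
      exact closure_minimal hzero (isClosed_eq (averageMulCLM f).continuous continuous_const)
    exact this hmem
  rw [averageMulCLM_apply, average_eq, smul_eq_mul, mul_eq_zero] at hcl
  have hne : ((volume : Measure (Fin m → simplex d)).real Set.univ)⁻¹ ≠ 0 :=
    inv_ne_zero (measureReal_univ_pi_pos d m).ne'
  have hintegral := hcl.resolve_left hne
  rw [integral_eq_zero_iff_of_nonneg (fun x => mul_self_nonneg _)
    (integrable_of_continuous (f.continuous.mul f.continuous))] at hintegral
  have := (Continuous.ae_eq_iff_eq volume (f.continuous.mul f.continuous)
    continuous_const).1 hintegral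
  ext x
  exact mul_self_eq_zero.1 (congrFun this x)

/-! ### The reproducing kernel on the diagonal -/

lemma weightB_pos {d : ℕ} {r γ : ℝ} (hγ : 0 < γ) (ℓ : ℕ) : 0 < weightB d r γ ℓ := by
  unfold weightB
  split_ifs with h
  · exact one_pos
  · have : (0 : ℝ) < ℓ := by exact_mod_cast Nat.pos_of_ne_zero h
    positivity

lemma projKernel_eq_sum {d ℓ : ℕ} (x y : simplex d) :
    projKernel d ℓ x y = ∑ k, MvPolynomial.eval x.1 (idxPoly (⟨ℓ, k⟩ : Idx d)) *
      MvPolynomial.eval y.1 (idxPoly (⟨ℓ, k⟩ : Idx d)) := rfl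

lemma projKernel_zero {d : ℕ} (x y : simplex d) : projKernel d 0 x y = 1 := by
  obtain ⟨a, ha, ha1⟩ := exists_idxPoly_zeroIdx d
  rw [projKernel_eq_sum, Finset.sum_congr rfl (g := fun _ => (1 : ℝ))]
  · simp [finrank_orthoSpace_zero]
  · intro k _
    rw [eq_zeroIdx (i := ⟨0, k⟩) rfl, ha]
    simpa using ha1

lemma sum_range_cTerm_le {d : ℕ} {r : ℝ} (hr : (d : ℝ) + 1 < r) (L : ℕ) :
    ∑ ℓ ∈ Finset.range L, cTerm d r ℓ.succPNat ≤ ∑' ℓ, cTerm d r ℓ := by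
  have h := (summable_cTerm hr).sum_le_tsum
    ((Finset.range L).map ⟨Nat.succPNat, Nat.succPNat_injective⟩) fun ℓ _ => cTerm_nonneg d r ℓ
  simpa using h

/-- These are the partial sums of the one-factor reproducing kernel at `(x, x)`: degree 0
contributes 1 and degree `ℓ` at most `M γ ℓ^{2d} / [ℓ(ℓ+d)]^r`. -/
lemma sum_sq_div_weightB_le {d : ℕ} {r γ : ℝ} (hr : (d : ℝ) + 1 < r) (hγ : 0 < γ) (x : simplex d)
    (F : Finset (Idx d)) :
    ∑ i ∈ F, MvPolynomial.eval x.1 (idxPoly i) ^ 2 / weightB d r γ i.1 ≤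
      1 + constC d r * γ := by
  set L := F.sup fun i => i.1 with hL
  -- Passing to all indices of degree at most `L` makes the sums over `k` complete, so that they
  -- become `projKernel`.
  have hF : F ⊆ (Finset.range (L + 1)).sigma fun _ => Finset.univ := by
    intro i hi
    simpa [Nat.lt_succ_iff] using Finset.le_sup (f := fun i : Idx d => i.1) hi
  calc _ ≤ ∑ i ∈ (Finset.range (L + 1)).sigma fun _ => Finset.univ,
        MvPolynomial.eval x.1 (idxPoly i) ^ 2 / weightB d r γ i.1 :=
        Finset.sum_le_sum_of_subset_of_nonneg hF fun i _ _ =>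
          div_nonneg (sq_nonneg _) (weightB_pos hγ _).le
    _ = ∑ ℓ ∈ Finset.range (L + 1), projKernel d ℓ x x / weightB d r γ ℓ := by
        rw [Finset.sum_sigma]
        refine Finset.sum_congr rfl fun ℓ _ => ?_
        rw [projKernel_eq_sum, Finset.sum_div]
        simp only [sq]
    _ ≤ (∑ ℓ ∈ Finset.range L, constM d * cTerm d r ℓ.succPNat * γ) + 1 := by
        rw [Finset.sum_range_succ', projKernel_zero]
        refine add_le_add (Finset.sum_le_sum fun ℓ _ => ?_) (by simp [weightB])
        have h1 := projKernel_self_le_constM (Nat.succ_pos ℓ) x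
        have hB := weightB_pos (d := d) (r := r) hγ (ℓ + 1)
        rw [div_le_iff₀ hB]
        refine h1.trans (le_of_eq ?_)
        have hpos : (0 : ℝ) < (((ℓ + 1 : ℕ) : ℝ) * ((ℓ + 1 : ℕ) + d)) ^ r := by positivity
        simp only [weightB, cTerm, Nat.succPNat_coe, Nat.succ_eq_add_one, Nat.add_eq_zero_iff,
          one_ne_zero, and_false, if_false]
        field_simp
    _ ≤ 1 + constC d r * γ := by
        rw [← Finset.sum_mul, ← Finset.mul_sum, constC, add_comm]
        have := sum_range_cTerm_le hr L
        have := constM_nonneg d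
        gcongr

/-- The squared norm weight of the basis function with index `i`. -/
def tensorWeight {d m : ℕ} (r : ℝ) (γ : Fin m → ℝ) (i : Fin m → Idx d) : ℝ :=
  ∏ j, weightB d r (γ j) (i j).1

lemma tensorWeight_pos {d m : ℕ} {r : ℝ} {γ : Fin m → ℝ} (hγ : ∀ j, 0 < γ j)
    (i : Fin m → Idx d) : 0 < tensorWeight r γ i :=
  Finset.prod_pos fun j _ => weightB_pos (hγ j) _

/-- The upper bound of the reproducing kernel of `H_m` on the diagonal. -/
def kernelBound (d : ℕ) {m : ℕ} (r : ℝ) (γ : Fin m → ℝ) : ℝ := ∏ j, (1 + constC d r * γ j)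

lemma one_le_kernelBound {d m : ℕ} {r : ℝ} {γ : Fin m → ℝ} (hγ : ∀ j, 0 < γ j) :
    1 ≤ kernelBound d r γ := by
  refine Finset.one_le_prod fun j _ => ?_
  have := mul_nonneg (constC_nonneg d r) (hγ j).le
  linarith

/-- A finite index set lies in a box, where the nonnegative sum factors over the coordinates. -/
lemma sum_sq_div_tensorWeight_le {d m : ℕ} {r : ℝ} (hr : (d : ℝ) + 1 < r) {γ : Fin m → ℝ}
    (hγ : ∀ j, 0 < γ j) (x : Fin m → simplex d) (S : Finset (Fin m → Idx d)) :
    ∑ i ∈ S, tensorBasis i x ^ 2 / tensorWeight r γ i ≤ kernelBound d r γ := by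
  classical
  set F : Fin m → Finset (Idx d) := fun j => S.image fun i => i j
  have hS : S ⊆ Fintype.piFinset F := fun i hi =>
    Fintype.mem_piFinset.2 fun j => Finset.mem_image_of_mem _ hi
  calc _ ≤ ∑ i ∈ Fintype.piFinset F, tensorBasis i x ^ 2 / tensorWeight r γ i :=
        Finset.sum_le_sum_of_subset_of_nonneg hS fun i _ _ =>
          div_nonneg (sq_nonneg _) (tensorWeight_pos hγ i).le
    _ = ∏ j, ∑ i ∈ F j, MvPolynomial.eval (x j).1 (idxPoly i) ^ 2 / weightB d r (γ j) i.1 := by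
        rw [Finset.prod_univ_sum]
        refine Finset.sum_congr rfl fun i _ => ?_
        rw [tensorBasis_apply, tensorWeight, ← Finset.prod_pow, ← Finset.prod_div_distrib]
    _ ≤ _ := Finset.prod_le_prod
        (fun j _ => Finset.sum_nonneg fun i _ => div_nonneg (sq_nonneg _) (weightB_pos (hγ j) _).le)
        fun j _ => sum_sq_div_weightB_le hr (hγ j) (x j) (F j)

/-! ### Fourier expansion of functions of finite norm -/

lemma normSq_eq {d m : ℕ} (r : ℝ) (γ : Fin m → ℝ) (f : C(Fin m → simplex d, ℝ)) :
    normSq r γ f = ∑' i, ENNReal.ofReal (tensorWeight r γ i * coeff f i ^ 2) := rfl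

lemma tensorWeight_mul_sq_nonneg {d m : ℕ} {r : ℝ} {γ : Fin m → ℝ} (hγ : ∀ j, 0 < γ j)
    (i : Fin m → Idx d) (c : ℝ) : 0 ≤ tensorWeight r γ i * c ^ 2 :=
  mul_nonneg (tensorWeight_pos hγ i).le (sq_nonneg _)

lemma sum_le_of_tsum_ofReal_le {ι : Type*} {g : ι → ℝ} (hg : ∀ i, 0 ≤ g i) {B : ℝ} (hB : 0 ≤ B)
    (h : ∑' i, ENNReal.ofReal (g i) ≤ ENNReal.ofReal B) (S : Finset ι) : ∑ i ∈ S, g i ≤ B := by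
  rw [← ENNReal.ofReal_le_ofReal_iff hB, ENNReal.ofReal_sum_of_nonneg fun i _ => hg i]
  exact (ENNReal.sum_le_tsum S).trans h

lemma tsum_ofReal_le_of_sum_le {ι : Type*} {g : ι → ℝ} (hg : ∀ i, 0 ≤ g i) {B : ℝ}
    (h : ∀ S : Finset ι, ∑ i ∈ S, g i ≤ B) : ∑' i, ENNReal.ofReal (g i) ≤ ENNReal.ofReal B := by
  rw [ENNReal.tsum_eq_iSup_sum]
  refine iSup_le fun S => ?_
  rw [← ENNReal.ofReal_sum_of_nonneg fun i _ => hg i]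
  exact ENNReal.ofReal_le_ofReal (h S)

lemma sq_sum_coeff_mul_le {d m : ℕ} {r : ℝ} {γ : Fin m → ℝ} (hγ : ∀ j, 0 < γ j)
    (c e : (Fin m → Idx d) → ℝ) (S : Finset (Fin m → Idx d)) :
    (∑ i ∈ S, c i * e i) ^ 2 ≤
      (∑ i ∈ S, tensorWeight r γ i * c i ^ 2) * ∑ i ∈ S, e i ^ 2 / tensorWeight r γ i := by
  refine Finset.sum_sq_le_sum_mul_sum_of_sq_le_mul S
    (fun i _ => tensorWeight_mul_sq_nonneg hγ i _)
    (fun i _ => div_nonneg (sq_nonneg _) (tensorWeight_pos hγ i).le) fun i _ => ?_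
  have := (tensorWeight_pos (r := r) hγ i).ne'
  exact le_of_eq (by field_simp)

/-- Cauchy–Schwarz bounds the uniform norm of a finite block by its norm in `H_m` times the square
root of the kernel bound, which gives the Cauchy criterion in `C((T^d)^m)`. -/
lemma summable_coeff_smul {d m : ℕ} {r : ℝ} (hr : (d : ℝ) + 1 < r) {γ : Fin m → ℝ}
    (hγ : ∀ j, 0 < γ j) {f : C(Fin m → simplex d, ℝ)} (hf : normSq r γ f ≠ ⊤) :
    Summable fun i => coeff f i • tensorBasis i := by
  have hs : Summable fun i => tensorWeight r γ i * coeff f i ^ 2 := by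
    refine (ENNReal.summable_toReal hf).congr fun i => ?_
    exact ENNReal.toReal_ofReal (tensorWeight_mul_sq_nonneg hγ i _)
  have hK := zero_lt_one.trans_le (one_le_kernelBound (d := d) (r := r) hγ)
  rw [summable_iff_vanishing_norm] at hs ⊢
  intro ε hε
  obtain ⟨s, hs⟩ := hs (ε ^ 2 / 4 / kernelBound d r γ) (by positivity)
  refine ⟨s, fun t ht => ?_⟩
  have h1 := (le_abs_self _).trans (hs t ht).le
  refine lt_of_le_of_lt ((ContinuousMap.norm_le _ (half_pos hε).le).2 fun x => ?_) (half_lt_self hε)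
  rw [ContinuousMap.sum_apply]
  simp only [ContinuousMap.smul_apply, smul_eq_mul, Real.norm_eq_abs]
  refine abs_le_of_sq_le_sq ?_ (half_pos hε).le
  calc _ ≤ _ := sq_sum_coeff_mul_le (r := r) hγ (coeff f) (fun i => tensorBasis i x) t
    _ ≤ ε ^ 2 / 4 / kernelBound d r γ * kernelBound d r γ :=
        mul_le_mul h1 (sum_sq_div_tensorWeight_le hr hγ x t)
          (Finset.sum_nonneg fun i _ => div_nonneg (sq_nonneg _) (tensorWeight_pos hγ i).le)
          (by positivity)
    _ = (ε / 2) ^ 2 := by field_simp; norm_num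

theorem hasSum_coeff_smul {d m : ℕ} {r : ℝ} (hr : (d : ℝ) + 1 < r) {γ : Fin m → ℝ}
    (hγ : ∀ j, 0 < γ j) {f : C(Fin m → simplex d, ℝ)} (hf : normSq r γ f ≠ ⊤) :
    HasSum (fun i => coeff f i • tensorBasis i) f := by
  have hs := (summable_coeff_smul hr hγ hf).hasSum
  set g := ∑' i, coeff f i • tensorBasis i
  -- The uniform sum has the same coefficients as `f`, and these determine a continuous function.
  have hg : ∀ i, coeff (g - f) i = 0 := by
    intro i
    rw [coeff_eq_averageMulCLM, map_sub, sub_eq_zero]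
    refine (((averageMulCLM (tensorBasis i)).hasSum hs).unique ?_)
    rw [← coeff_eq_averageMulCLM]
    convert hasSum_ite_eq i (coeff f i) using 1
    ext i'
    simp only [map_smul, ← coeff_eq_averageMulCLM, coeff_tensorBasis,
      smul_eq_mul, mul_ite, mul_one, mul_zero]
    split_ifs with h
    · rw [h]
    · rfl
  rwa [sub_eq_zero.1 (eq_zero_of_coeff_eq_zero hg)] at hs

/-! ### The integration error of a basis function -/

/-- The integration error of a QMC rule as a functional. -/
def errCLM {d m n : ℕ} (t : Fin n → Fin m → simplex d) : C(Fin m → simplex d, ℝ) →L[ℝ] ℝ :=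
  averageMulCLM 1 - (1 / (n : ℝ)) • ∑ s, ContinuousMap.evalCLM ℝ (t s)

lemma integ_eq_averageMulCLM {d m : ℕ} (f : C(Fin m → simplex d, ℝ)) :
    integ f = averageMulCLM 1 f := by
  simp [integ, averageMulCLM_apply]

lemma errCLM_apply {d m n : ℕ} (t : Fin n → Fin m → simplex d) (f : C(Fin m → simplex d, ℝ)) :
    errCLM t f = integ f - qmc t f := by
  simp [errCLM, integ_eq_averageMulCLM, qmc]

/-- The basis function with index `i` minus its mean. -/
def centeredBasis {d m : ℕ} (i : Fin m → Idx d) : C(Fin m → simplex d, ℝ) :=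
  tensorBasis i - ContinuousMap.const _ (integ (tensorBasis i))

lemma errCLM_tensorBasis {d m n : ℕ} (hn : 0 < n) (t : Fin n → Fin m → simplex d)
    (i : Fin m → Idx d) :
    errCLM t (tensorBasis i) = -(1 / (n : ℝ)) * ∑ s, centeredBasis i (t s) := by
  have : (n : ℝ) ≠ 0 := by positivity
  rw [errCLM_apply, qmc]
  simp only [centeredBasis, ContinuousMap.sub_apply, ContinuousMap.const_apply,
    Finset.sum_sub_distrib, Finset.sum_const, Finset.card_univ, Fintype.card_fin, nsmul_eq_mul]
  field_simp
  ring

instance instNeZeroVolumePi (d m : ℕ) : NeZero (volume : Measure (Fin m → simplex d)) := by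
  refine ⟨fun h => (measureReal_univ_pi_pos d m).ne' ?_⟩
  rw [h]; rfl

instance instIsFiniteMeasurePi (d m : ℕ) :
    IsFiniteMeasure (volume : Measure (Fin m → simplex d)) := by
  rw [volume_pi]; infer_instance

lemma averageMulCLM_one_one (d m : ℕ) :
    averageMulCLM (1 : C(Fin m → simplex d, ℝ)) 1 = 1 := by
  simp [averageMulCLM_apply]

lemma averageMulCLM_tensorBasis_self {d m : ℕ} (i : Fin m → Idx d) :
    averageMulCLM (tensorBasis i) (tensorBasis i) = 1 := by
  rw [← coeff_eq_averageMulCLM, coeff_tensorBasis, if_pos rfl]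

/-- The centred function has mean zero, which removes the cross term, and variance `1 - b² ≤ 1`. -/
lemma average_sq_add_centeredBasis_le {d m : ℕ} (i : Fin m → Idx d) (a : ℝ) :
    ⨍ x, (a + centeredBasis i x) ^ 2 ≤ a ^ 2 + 1 := by
  set b := integ (tensorBasis i) with hb
  have e : ⨍ x, (a + centeredBasis i x) ^ 2 =
      averageMulCLM (tensorBasis i + (a - b) • 1) (tensorBasis i + (a - b) • 1) := by
    rw [averageMulCLM_apply]
    congr 1
    ext x
    simp [centeredBasis, ← hb]
    ring
  have h1 : averageMulCLM (tensorBasis i + (a - b) • 1) (tensorBasis i) = 1 + (a - b) * b := by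
    rw [averageMulCLM_comm, map_add, map_smul, averageMulCLM_tensorBasis_self, averageMulCLM_comm,
      ← integ_eq_averageMulCLM, smul_eq_mul]
  have h2 : averageMulCLM (tensorBasis i + (a - b) • 1) 1 = b + (a - b) := by
    rw [averageMulCLM_comm, map_add, map_smul, averageMulCLM_one_one, ← integ_eq_averageMulCLM,
      smul_eq_mul, mul_one]
  rw [e, map_add, map_smul, h1, h2, smul_eq_mul]
  nlinarith [sq_nonneg b]

/-- Each squared basis function has mean 1, so the left side is the mean of a partial sum of the
kernel diagonal, hence at most its value at some point. -/
lemma sum_inv_tensorWeight_le {d m : ℕ} {r : ℝ} (hr : (d : ℝ) + 1 < r) {γ : Fin m → ℝ}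
    (hγ : ∀ j, 0 < γ j) (S : Finset (Fin m → Idx d)) :
    ∑ i ∈ S, 1 / tensorWeight r γ i ≤ kernelBound d r γ := by
  set g : C(Fin m → simplex d, ℝ) :=
    ∑ i ∈ S, (1 / tensorWeight r γ i) • (tensorBasis i * tensorBasis i) with hg
  have h1 : ∑ i ∈ S, 1 / tensorWeight r γ i = ⨍ x, g x := by
    change _ = integ g
    rw [integ_eq_averageMulCLM, hg, map_sum]
    refine Finset.sum_congr rfl fun i _ => ?_
    have : averageMulCLM 1 (tensorBasis i * tensorBasis i) = 1 := by
      rw [← averageMulCLM_tensorBasis_self i, averageMulCLM_apply, averageMulCLM_apply]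
      simp
    rw [map_smul, this, smul_eq_mul, mul_one]
  obtain ⟨x, hx⟩ := exists_average_le (μ := volume) (NeZero.ne _)
    (integrable_of_continuous g.continuous)
  rw [h1]
  refine hx.trans ((le_of_eq ?_).trans (sum_sq_div_tensorWeight_le hr hγ x S))
  rw [hg, ContinuousMap.sum_apply]
  refine Finset.sum_congr rfl fun i _ => ?_
  simp
  ring

lemma laverage_tsum_sq_add_centeredBasis_le {d m : ℕ} {r : ℝ} (hr : (d : ℝ) + 1 < r)
    {γ : Fin m → ℝ} (hγ : ∀ j, 0 < γ j) (a : (Fin m → Idx d) → ℝ) :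
    ⨍⁻ x, ∑' i, ENNReal.ofReal ((a i + centeredBasis i x) ^ 2 / tensorWeight r γ i) ≤
      ∑' i, ENNReal.ofReal (a i ^ 2 / tensorWeight r γ i) +
        ENNReal.ofReal (kernelBound d r γ) := by
  rw [laverage_eq', lintegral_tsum fun i =>
    (Continuous.measurable (by fun_prop)).ennreal_ofReal.aemeasurable]
  have h2 := tsum_ofReal_le_of_sum_le (fun i => (one_div_pos.2 (tensorWeight_pos hγ i)).le)
    (sum_inv_tensorWeight_le hr hγ)
  refine le_trans ?_ (add_le_add_right h2 _)
  rw [← ENNReal.tsum_add]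
  refine ENNReal.tsum_le_tsum fun i => ?_
  have hw := tensorWeight_pos (r := r) hγ i
  rw [← laverage_eq', laverage_eq, ← ofReal_average (integrable_of_continuous (by fun_prop))
    (.of_forall fun x => div_nonneg (sq_nonneg _) hw.le),
    ← ENNReal.ofReal_add (div_nonneg (sq_nonneg _) hw.le) (one_div_pos.2 hw).le]
  refine ENNReal.ofReal_le_ofReal ?_
  rw [← add_div, average_eq, integral_div, ← smul_div_assoc, ← average_eq]
  exact div_le_div_of_nonneg_right (average_sq_add_centeredBasis_le i (a i)) hw.le

/-! ### Existence of good points -/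

/-- Points are chosen one by one. Averaged over the next point, the weighted sum of squares grows by
at most `kernelBound`, so some choice does no worse. -/
lemma exists_points {d m : ℕ} {r : ℝ} (hr : (d : ℝ) + 1 < r) {γ : Fin m → ℝ}
    (hγ : ∀ j, 0 < γ j) (n : ℕ) : ∃ t : Fin n → Fin m → simplex d,
      ∑' i, ENNReal.ofReal ((∑ s, centeredBasis i (t s)) ^ 2 / tensorWeight r γ i) ≤
        ENNReal.ofReal (n * kernelBound d r γ) := by
  have hK := zero_le_one.trans (one_le_kernelBound (d := d) (r := r) hγ)
  induction n with
  | zero => exact ⟨Fin.elim0, by simp⟩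
  | succ n ih =>
    obtain ⟨t, ht⟩ := ih
    obtain ⟨x, hx⟩ := exists_le_laverage (μ := volume) (f := fun x => ∑' i,
      ENNReal.ofReal ((∑ s, centeredBasis i (t s) + centeredBasis i x) ^ 2 / tensorWeight r γ i))
      (NeZero.ne _) (AEMeasurable.tsum fun i =>
        (Continuous.measurable (by fun_prop)).ennreal_ofReal.aemeasurable)
    refine ⟨Fin.cons x t, ?_⟩
    simp only [Fin.sum_univ_succ, Fin.cons_zero, Fin.cons_succ]
    calc _ = ∑' i, ENNReal.ofReal
          ((∑ s, centeredBasis i (t s) + centeredBasis i x) ^ 2 / tensorWeight r γ i) := by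
          simp only [add_comm]
      _ ≤ _ := hx
      _ ≤ _ := laverage_tsum_sq_add_centeredBasis_le hr hγ _
      _ ≤ _ := add_le_add_left ht _
      _ = _ := by
        rw [← ENNReal.ofReal_add (by positivity) hK]
        congr 1
        push_cast; ring

/-- Cauchy–Schwarz applied to the partial sums of the Fourier series of `f`, pairing its
coefficients with the errors of the basis functions. -/
lemma abs_errCLM_le {d m n : ℕ} {r : ℝ} (hr : (d : ℝ) + 1 < r) {γ : Fin m → ℝ}
    (hγ : ∀ j, 0 < γ j) (hn : 0 < n) {t : Fin n → Fin m → simplex d}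
    (ht : ∑' i, ENNReal.ofReal ((∑ s, centeredBasis i (t s)) ^ 2 / tensorWeight r γ i) ≤
        ENNReal.ofReal (n * kernelBound d r γ)) {f : C(Fin m → simplex d, ℝ)}
    (hf : normSq r γ f ≤ 1) : |errCLM t f| ≤ √(kernelBound d r γ / n) := by
  have hK := zero_le_one.trans (one_le_kernelBound (d := d) (r := r) hγ)
  have hn' : (0 : ℝ) < n := by exact_mod_cast hn
  have hs := (errCLM t).hasSum
    (hasSum_coeff_smul hr hγ (hf.trans_lt ENNReal.one_lt_top).ne)
  refine le_of_tendsto hs.abs (.of_forall fun S => ?_)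
  refine Real.abs_le_sqrt ?_
  simp only [map_smul, smul_eq_mul, errCLM_tensorBasis hn]
  rw [← ENNReal.ofReal_one, normSq_eq] at hf
  have h1 := sum_le_of_tsum_ofReal_le (fun i => tensorWeight_mul_sq_nonneg hγ i _)
    zero_le_one hf S
  have h2 := sum_le_of_tsum_ofReal_le
    (fun i => div_nonneg (sq_nonneg _) (tensorWeight_pos hγ i).le) (by positivity) ht S
  calc _ ≤ _ := sq_sum_coeff_mul_le (r := r) hγ _ _ S
    _ ≤ 1 * ((1 / (n : ℝ)) ^ 2 * (n * kernelBound d r γ)) := by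
        refine mul_le_mul h1 ?_
          (Finset.sum_nonneg fun i _ => div_nonneg (sq_nonneg _) (tensorWeight_pos hγ i).le)
          zero_le_one
        refine le_trans (le_of_eq ?_) (mul_le_mul_of_nonneg_left h2 (sq_nonneg _))
        rw [Finset.mul_sum]
        refine Finset.sum_congr rfl fun i _ => ?_
        ring
    _ = _ := by field_simp

theorem exists_wce_le {d m n : ℕ} {r : ℝ} (hr : (d : ℝ) + 1 < r) {γ : Fin m → ℝ}
    (hγ : ∀ j, 0 < γ j) (hn : 0 < n) : ∃ t : Fin n → Fin m → simplex d,
      wce r γ t ≤ ENNReal.ofReal √(kernelBound d r γ / n) := by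
  obtain ⟨t, ht⟩ := exists_points hr hγ n
  refine ⟨t, iSup_le fun f => iSup_le fun _ => iSup_le fun hf => ENNReal.ofReal_le_ofReal ?_⟩
  rw [← errCLM_apply]
  exact abs_errCLM_le hr hγ hn ht hf

/-! ### The initial error -/

/-- The multi-index of the constant function. -/
def zeroMulti (d m : ℕ) : Fin m → Idx d := fun _ => zeroIdx d

lemma exists_tensorBasis_zeroMulti (d m : ℕ) :
    ∃ a : ℝ, a * a = 1 ∧ tensorBasis (zeroMulti d m) = a • 1 := by
  obtain ⟨a, ha, ha1⟩ := exists_idxPoly_zeroIdx d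
  refine ⟨a ^ m, by rw [← mul_pow, ha1, one_pow], ?_⟩
  ext x
  simp [tensorBasis_apply, zeroMulti, ha]

lemma tensorWeight_zeroMulti {d m : ℕ} (r : ℝ) (γ : Fin m → ℝ) :
    tensorWeight r γ (zeroMulti d m) = 1 := by
  simp [tensorWeight, zeroMulti, zeroIdx, weightB]

lemma coeff_zeroMulti_sq {d m : ℕ} (f : C(Fin m → simplex d, ℝ)) :
    coeff f (zeroMulti d m) ^ 2 = integ f ^ 2 := by
  obtain ⟨a, ha, h⟩ := exists_tensorBasis_zeroMulti d m
  rw [coeff_eq_averageMulCLM, averageMulCLM_comm, h, map_smul, averageMulCLM_comm,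
    ← integ_eq_averageMulCLM, smul_eq_mul]
  linear_combination integ f ^ 2 * ha

lemma integ_tensorBasis {d m : ℕ} {i : Fin m → Idx d} (hi : i ≠ zeroMulti d m) :
    integ (tensorBasis i) = 0 := by
  have := coeff_zeroMulti_sq (tensorBasis i)
  rw [coeff_tensorBasis, if_neg hi] at this
  simpa using this.symm

lemma normSq_zero {d m : ℕ} (r : ℝ) (γ : Fin m → ℝ) :
    normSq r γ (0 : C(Fin m → simplex d, ℝ)) = 0 := by
  simp [normSq_eq, coeff_eq_averageMulCLM]

lemma memH_of_mem_span {d m : ℕ} {r : ℝ} {γ : Fin m → ℝ} {f : C(Fin m → simplex d, ℝ)}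
    (hf : f ∈ Submodule.span ℝ (Set.range tensorBasis)) : MemH r γ f := by
  intro δ hδ
  refine ⟨f, Submodule.span_mono ?_ hf, by rwa [sub_self, normSq_zero]⟩
  rintro _ ⟨i, rfl⟩
  refine ⟨_, fun j ε hε => ⟨idxPoly (i j), ?_⟩, rfl⟩
  rw [sub_self]
  simpa [normSq₁, coeff₁] using hε

lemma normSq_sum_smul {d m : ℕ} {r : ℝ} {γ : Fin m → ℝ} (hγ : ∀ j, 0 < γ j)
    (S : Finset (Fin m → Idx d)) (c : (Fin m → Idx d) → ℝ) :
    normSq r γ (∑ i ∈ S, c i • tensorBasis i) =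
      ENNReal.ofReal (∑ i ∈ S, tensorWeight r γ i * c i ^ 2) := by
  classical
  have h : ∀ i', coeff (∑ i ∈ S, c i • tensorBasis i) i' = if i' ∈ S then c i' else 0 := by
    intro i'
    rw [coeff_eq_averageMulCLM, map_sum]
    simp only [map_smul, ← coeff_eq_averageMulCLM, coeff_tensorBasis, smul_eq_mul, mul_ite, mul_one,
      mul_zero]
    rw [Finset.sum_ite_eq']
  rw [normSq_eq, ENNReal.ofReal_sum_of_nonneg fun i _ => tensorWeight_mul_sq_nonneg hγ i _,
    tsum_eq_sum (s := S)]
  · exact Finset.sum_congr rfl fun i hi => by rw [h, if_pos hi]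
  · intro i hi
    simp [h, hi]

/-- The constant index has weight 1 and its coefficient is the integral up to sign; a constant
function of modulus 1 attains the bound. -/
theorem initErr_eq_one {d m : ℕ} {r : ℝ} {γ : Fin m → ℝ} (hγ : ∀ j, 0 < γ j) :
    initErr d r γ = 1 := by
  apply le_antisymm
  · refine iSup_le fun f => iSup_le fun _ => iSup_le fun hf => ?_
    rw [← ENNReal.ofReal_one] at hf ⊢
    refine ENNReal.ofReal_le_ofReal ?_
    have := sum_le_of_tsum_ofReal_le (fun i => tensorWeight_mul_sq_nonneg hγ i _)
      zero_le_one hf {zeroMulti d m}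
    rw [Finset.sum_singleton, tensorWeight_zeroMulti, one_mul, coeff_zeroMulti_sq] at this
    exact abs_le_one_iff_mul_self_le_one.2 (by rwa [← sq])
  · have hn : normSq r γ (tensorBasis (zeroMulti d m)) ≤ 1 := by
      have := normSq_sum_smul (r := r) hγ {zeroMulti d m} fun _ => 1
      simp only [Finset.sum_singleton, one_smul, tensorWeight_zeroMulti] at this
      simp [this]
    refine le_iSup_of_le (tensorBasis (zeroMulti d m)) (le_iSup_of_le
      (memH_of_mem_span (Submodule.subset_span ⟨_, rfl⟩)) (le_iSup_of_le hn ?_))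
    have := coeff_zeroMulti_sq (tensorBasis (zeroMulti d m))
    rw [coeff_tensorBasis, if_pos rfl, one_pow] at this
    have habs : |integ (tensorBasis (zeroMulti d m))| = 1 := by
      rw [← Real.sqrt_sq_eq_abs, ← this, Real.sqrt_one]
    rw [habs, ENNReal.ofReal_one]

theorem reduces_of_le {d : ℕ} {r : ℝ} (hr : (d : ℝ) + 1 < r) {γ : (m : ℕ) → Fin m → ℝ} {m n : ℕ}
    (hγ : ∀ j, 0 < γ m j) {ε : ℝ} (hε : 0 < ε) (hn : ε ^ (-2 : ℝ) * kernelBound d r (γ m) ≤ n) :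
    Reduces d r γ ε m n := by
  have hK := zero_lt_one.trans_le (one_le_kernelBound (d := d) (r := r) hγ)
  have hn0 : (0 : ℝ) < n := lt_of_lt_of_le (by positivity) hn
  obtain ⟨t, ht⟩ := exists_wce_le hr hγ (n := n) (by exact_mod_cast hn0)
  refine ⟨t, ht.trans ?_⟩
  rw [initErr_eq_one hγ, mul_one]
  refine ENNReal.ofReal_le_ofReal (Real.sqrt_le_iff.2 ⟨hε.le, ?_⟩)
  rw [Real.rpow_neg hε.le, Real.rpow_two, inv_mul_le_iff₀ (by positivity)] at hn
  rwa [div_le_iff₀ hn0]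

theorem minPoints_le {d : ℕ} {r : ℝ} (hr : (d : ℝ) + 1 < r) {γ : (m : ℕ) → Fin m → ℝ} {m : ℕ}
    (hγ : ∀ j, 0 < γ m j) {ε : ℝ} (hε : ε ∈ Set.Ioo (0 : ℝ) 1) :
    (minPoints d r γ ε m : ℝ) ≤ 2 * ε ^ (-2 : ℝ) * kernelBound d r (γ m) := by
  have hK := one_le_kernelBound (d := d) (r := r) hγ
  have h1 : 1 ≤ ε ^ (-2 : ℝ) :=
    Real.one_le_rpow_of_pos_of_le_one_of_nonpos hε.1 hε.2.le (by norm_num)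
  have h2 : minPoints d r γ ε m ≤ ⌈ε ^ (-2 : ℝ) * kernelBound d r (γ m)⌉₊ :=
    Nat.sInf_le (reduces_of_le hr hγ hε.1 (Nat.le_ceil _))
  -- Rounding up costs less than 1, and the rounded quantity is at least 1; hence the factor 2.
  have h3 := Nat.ceil_lt_add_one (zero_le_one.trans (one_le_mul_of_one_le_of_one_le h1 hK))
  have h4 := one_le_mul_of_one_le_of_one_le h1 hK
  have h5 : (minPoints d r γ ε m : ℝ) ≤ ⌈ε ^ (-2 : ℝ) * kernelBound d r (γ m)⌉₊ := by
    exact_mod_cast h2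
  linarith

/-! ### Lower bound -/

lemma continuous_projKernel_self (d ℓ : ℕ) : Continuous fun x : simplex d => projKernel d ℓ x x :=
  continuous_finsetSum _ fun _ _ => (continuous_evalOn _).mul (continuous_evalOn _)

lemma polyInner_C_one {d : ℕ} (a : ℝ) :
    polyInner (MvPolynomial.C a : MvPolynomial (Fin d) ℝ) 1 = a := by
  simp [polyInner]

/-- If both kernels vanish at `(x, x)`, all basis polynomials of degrees 1 and 2 vanish at `x`, as
do their means; so evaluation at `x` agrees with averaging. -/
lemma eval_eq_polyInner_one {d : ℕ} {x : simplex d}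
    (hx : projKernel d 1 x x + projKernel d 2 x x = 0) {p : MvPolynomial (Fin d) ℝ}
    (hp : p.totalDegree ≤ 2) : MvPolynomial.eval x.1 p = polyInner p 1 := by
  have h1 : projKernel d 1 x x = 0 := by
    linarith [projKernel_self_nonneg (ℓ := 1) x, projKernel_self_nonneg (ℓ := 2) x]
  have h2 : projKernel d 2 x x = 0 := by linarith
  have hz : ∀ i : Idx d, projKernel d i.1 x x = 0 → MvPolynomial.eval x.1 (idxPoly i) = 0 := by
    rintro ⟨ℓ, k⟩ h
    rw [projKernel_eq_sum, Finset.sum_eq_zero_iff_of_nonneg fun _ _ => mul_self_nonneg _] at h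
    exact mul_self_eq_zero.1 (h k (Finset.mem_univ k))
  have hspan := mem_span_idxPoly hp
  clear hp
  induction hspan using Submodule.span_induction with
  | mem p hp =>
    obtain ⟨i, hi, rfl⟩ := hp
    have hi' : i.1 ≤ 2 := hi
    by_cases h0 : i.1 = 0
    · obtain ⟨a, ha, _⟩ := exists_idxPoly_zeroIdx d
      rw [eq_zeroIdx h0, ha, polyInner_C_one, MvPolynomial.eval_C]
    · rw [hz i (by
        rcases (by omega : i.1 = 1 ∨ i.1 = 2) with h | h <;> rw [h] <;> assumption)]
      refine ((orthoPoly_mem d i.1 i.2).2 1 ?_).symm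
      simpa using Nat.pos_of_ne_zero h0
  | zero => simp [polyInner]
  | add p q _ _ hp hq => rw [map_add, polyInner_add_left, hp, hq]
  | smul a p _ hp => rw [MvPolynomial.smul_eval, polyInner_smul_left, hp]

/-- At a zero, the square `(X₀ - x₀)²` would have mean equal to its value 0 at `x`, which is
impossible; compactness gives a uniform `κ`. Degree 1 alone would not do, since mean-zero affine
functions vanish at the centroid. -/
lemma exists_pos_le_projKernel {d : ℕ} (hd : 1 ≤ d) :
    ∃ κ > 0, ∀ x : simplex d, κ ≤ projKernel d 1 x x + projKernel d 2 x x := by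
  obtain ⟨x, -, hx⟩ := isCompact_univ.exists_isMinOn (Set.univ_nonempty (α := simplex d))
    ((continuous_projKernel_self d 1).add (continuous_projKernel_self d 2)).continuousOn
  refine ⟨_, ?_, fun y => hx (Set.mem_univ y)⟩
  refine lt_of_le_of_ne (add_nonneg (projKernel_self_nonneg x) (projKernel_self_nonneg x))
    fun h => ?_
  set g : MvPolynomial (Fin d) ℝ := MvPolynomial.X ⟨0, hd⟩ - MvPolynomial.C (x.1 ⟨0, hd⟩) with hg
  have hdeg : (g * g).totalDegree ≤ 2 := by
    have : g.totalDegree ≤ 1 := (MvPolynomial.totalDegree_sub _ _).trans (by simp)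
    exact (MvPolynomial.totalDegree_mul _ _).trans (by omega)
  have h1 := eval_eq_polyInner_one h.symm hdeg
  have h2 : polyInner (g * g) 1 = polyInner g g := by simp [polyInner]
  have h3 : MvPolynomial.eval x.1 g = 0 := by simp [hg]
  rw [h2, map_mul, h3, mul_zero] at h1
  have h4 := eq_zero_of_polyInner_self g h1.symm
  have h5 : (MvPolynomial.X ⟨0, hd⟩ : MvPolynomial (Fin d) ℝ) = MvPolynomial.C (x.1 ⟨0, hd⟩) :=
    sub_eq_zero.1 h4
  have := congrArg MvPolynomial.totalDegree h5
  simp at this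

/-- The indices of the basis polynomials of degree at most two. -/
def lowIdx (d : ℕ) : Finset (Idx d) := (Finset.range 3).sigma fun _ => Finset.univ

lemma mem_lowIdx {d : ℕ} {i : Idx d} : i ∈ lowIdx d ↔ i.1 ≤ 2 := by
  simp [lowIdx, Nat.lt_succ_iff]

/-- The coefficient of `P_ℓ` in `1 + s (P_1 + P_2)`. -/
def lowCoeff (s : ℝ) (ℓ : ℕ) : ℝ := if ℓ = 0 then 1 else s

/-- The coefficient of the basis function with index `i` in `∏_j (1 + s_j (P_1 + P_2))`. -/
def tensorLowCoeff {d m : ℕ} (s : Fin m → ℝ) (i : Fin m → Idx d) : ℝ := ∏ j, lowCoeff (s j) (i j).1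

lemma tensorLowCoeff_nonneg {d m : ℕ} {s : Fin m → ℝ} (hs : ∀ j, 0 ≤ s j) (i : Fin m → Idx d) :
    0 ≤ tensorLowCoeff s i :=
  Finset.prod_nonneg fun j _ => by unfold lowCoeff; split_ifs; exacts [zero_le_one, hs j]

/-- The kernel `∏_j (1 + s_j (P_1(x_j, y_j) + P_2(x_j, y_j)))`. -/
def lowKernel {d m : ℕ} (s : Fin m → ℝ) (x y : Fin m → simplex d) : ℝ :=
  ∏ j, (1 + s j * (projKernel d 1 (x j) (y j) + projKernel d 2 (x j) (y j)))

lemma sum_tensorLowCoeff {d m : ℕ} (s : Fin m → ℝ) (x y : Fin m → simplex d) :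
    ∑ i ∈ Fintype.piFinset fun _ => lowIdx d,
      tensorLowCoeff s i * (tensorBasis i x * tensorBasis i y) = lowKernel s x y := by
  have h : ∀ j, ∑ i ∈ lowIdx d, lowCoeff (s j) i.1 *
      (MvPolynomial.eval (x j).1 (idxPoly i) * MvPolynomial.eval (y j).1 (idxPoly i)) =
      1 + s j * (projKernel d 1 (x j) (y j) + projKernel d 2 (x j) (y j)) := by
    intro j
    rw [lowIdx, Finset.sum_sigma]
    simp only [← Finset.mul_sum, ← projKernel_eq_sum]
    rw [Finset.sum_range_succ, Finset.sum_range_succ, Finset.sum_range_one, projKernel_zero]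
    simp [lowCoeff]
    ring
  rw [lowKernel, ← Finset.prod_congr rfl fun j _ => h j, Finset.prod_univ_sum]
  refine Finset.sum_congr rfl fun i _ => ?_
  rw [tensorLowCoeff, tensorBasis_apply, tensorBasis_apply, ← Finset.prod_mul_distrib,
    ← Finset.prod_mul_distrib]

lemma sum_tensorLowCoeff_mul_sq {d m n : ℕ} (s : Fin m → ℝ) (t : Fin n → Fin m → simplex d) :
    ∑ i ∈ Fintype.piFinset fun _ => lowIdx d,
      tensorLowCoeff s i * (∑ a, tensorBasis i (t a)) ^ 2 = ∑ a, ∑ b, lowKernel s (t a) (t b) := by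
  simp only [← sum_tensorLowCoeff, sq, Finset.mul_sum]
  rw [Finset.sum_comm]
  refine Finset.sum_congr rfl fun a _ => ?_
  rw [Finset.sum_comm]
  refine Finset.sum_congr rfl fun i _ => ?_
  rw [mul_comm (∑ a, tensorBasis i (t a)), Finset.mul_sum, Finset.mul_sum]

/-- Makes the coefficients of the auxiliary kernel at most the coefficients `1 / B(ℓ)` of the
reproducing kernel; degree 2 is the worst case. -/
lemma weightB_mul_lowCoeff_le {d : ℕ} {r η γ : ℝ} (hr : 0 ≤ r) (hη : 0 ≤ η) (hγ : 0 < γ)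
    (h : η * (2 * (2 + (d : ℝ))) ^ r ≤ 1) {ℓ : ℕ} (hℓ : ℓ ≤ 2) :
    weightB d r γ ℓ * lowCoeff (η * γ) ℓ ≤ 1 := by
  unfold weightB lowCoeff
  split_ifs with h0
  · simp
  · have hℓ' : (ℓ : ℝ) ≤ 2 := by exact_mod_cast hℓ
    calc _ = η * ((ℓ : ℝ) * (ℓ + d)) ^ r := by field_simp
      _ ≤ η * (2 * (2 + (d : ℝ))) ^ r := by gcongr
      _ ≤ 1 := h

lemma tensorWeight_mul_tensorLowCoeff_le {d m : ℕ} {r η : ℝ} {γ : Fin m → ℝ} (hr : 0 ≤ r)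
    (hη : 0 ≤ η) (hγ : ∀ j, 0 < γ j) (h : η * (2 * (2 + (d : ℝ))) ^ r ≤ 1) {i : Fin m → Idx d}
    (hi : i ∈ Fintype.piFinset fun _ => lowIdx d) :
    tensorWeight r γ i * tensorLowCoeff (fun j => η * γ j) i ≤ 1 := by
  rw [tensorWeight, tensorLowCoeff, ← Finset.prod_mul_distrib]
  refine Finset.prod_le_one (fun j _ => mul_nonneg (weightB_pos (hγ j) _).le ?_) fun j _ =>
    weightB_mul_lowCoeff_le hr hη (hγ j) h (mem_lowIdx.1 (Fintype.mem_piFinset.1 hi j))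
  unfold lowCoeff
  split_ifs
  exacts [zero_le_one, mul_nonneg hη (hγ j).le]

lemma zeroMulti_mem_piFinset (d m : ℕ) : zeroMulti d m ∈ Fintype.piFinset fun _ => lowIdx d :=
  Fintype.mem_piFinset.2 fun _ => mem_lowIdx.2 (Nat.zero_le 2)

lemma sq_sum_tensorBasis_zeroMulti {d m n : ℕ} (t : Fin n → Fin m → simplex d) :
    (∑ a, tensorBasis (zeroMulti d m) (t a)) ^ 2 = (n : ℝ) ^ 2 := by
  obtain ⟨a, ha, h⟩ := exists_tensorBasis_zeroMulti d m
  simp [h]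
  linear_combination (n : ℝ) ^ 2 * ha

/-- The worst-case error is bounded below by means of the kernel `lowKernel`. -/
lemma sum_lowKernel_le {d m n : ℕ} {r η ε : ℝ} {γ : Fin m → ℝ} (hr : 0 ≤ r)
    (hη : 0 ≤ η) (hγ : ∀ j, 0 < γ j) (h : η * (2 * (2 + (d : ℝ))) ^ r ≤ 1) (hn : 0 < n)
    (hε : 0 ≤ ε) {t : Fin n → Fin m → simplex d} (ht : wce r γ t ≤ ENNReal.ofReal ε) :
    ∑ a, ∑ b, lowKernel (fun j => η * γ j) (t a) (t b) ≤ (1 + ε ^ 2) * (n : ℝ) ^ 2 := by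
  classical
  have hn' : (0 : ℝ) < n := by exact_mod_cast hn
  set u : (Fin m → Idx d) → ℝ := tensorLowCoeff fun j => η * γ j with hu
  have hu0 : ∀ i, 0 ≤ u i := tensorLowCoeff_nonneg fun j => mul_nonneg hη (hγ j).le
  set b : (Fin m → Idx d) → ℝ := fun i => ∑ a, tensorBasis i (t a) with hb
  set P : Finset (Fin m → Idx d) := Fintype.piFinset fun _ => lowIdx d with hP
  set S := P.erase (zeroMulti d m) with hS
  set N := ∑ i ∈ S, u i * b i ^ 2 with hN
  -- The constant index contributes exactly `n²`; `N` collects the remaining indices.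
  have hsum : ∑ a, ∑ b, lowKernel (fun j => η * γ j) (t a) (t b) = (n : ℝ) ^ 2 + N := by
    rw [← sum_tensorLowCoeff_mul_sq, hN, hS,
      ← Finset.add_sum_erase P _ (zeroMulti_mem_piFinset d m)]
    congr 1
    rw [sq_sum_tensorBasis_zeroMulti]
    simp [tensorLowCoeff, lowCoeff, zeroMulti, zeroIdx]
  rw [hsum]
  have hN0 : 0 ≤ N := Finset.sum_nonneg fun i _ => mul_nonneg (hu0 i) (sq_nonneg _)
  rcases hN0.eq_or_lt with h0 | hNpos
  · rw [← h0]; nlinarith [mul_nonneg (sq_nonneg ε) (sq_nonneg (n : ℝ))]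
  have hsq : 0 < √N := Real.sqrt_pos.2 hNpos
  -- The normalised representer, for the auxiliary kernel, of point-value sums on nonconstant
  -- indices. Its norm is at most 1 and its error is `-√N / n`, so error at most `ε` gives `N ≤ ε²
  -- n²`.
  set f : C(Fin m → simplex d, ℝ) := ∑ i ∈ S, (u i * b i / √N) • tensorBasis i with hf
  have hmem : MemH r γ f := memH_of_mem_span (Submodule.sum_mem _ fun i _ =>
    Submodule.smul_mem _ _ (Submodule.subset_span ⟨i, rfl⟩))
  have hnorm : normSq r γ f ≤ 1 := by
    rw [hf, normSq_sum_smul hγ, ← ENNReal.ofReal_one]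
    refine ENNReal.ofReal_le_ofReal ?_
    calc _ ≤ ∑ i ∈ S, u i * b i ^ 2 / N := by
          refine Finset.sum_le_sum fun i hi => ?_
          have h1 := tensorWeight_mul_tensorLowCoeff_le hr hη hγ h (Finset.mem_of_mem_erase hi)
          rw [div_pow, Real.sq_sqrt hN0, mul_div_assoc']
          refine div_le_div_of_nonneg_right ?_ hN0
          calc _ = (tensorWeight r γ i * u i) * (u i * b i ^ 2) := by ring
            _ ≤ 1 * (u i * b i ^ 2) :=
              mul_le_mul_of_nonneg_right h1 (mul_nonneg (hu0 i) (sq_nonneg _))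
            _ = _ := one_mul _
      _ = 1 := by rw [← Finset.sum_div, div_self hNpos.ne']
  have herr : errCLM t f = -(√N / n) := by
    rw [hf, map_sum]
    have : ∀ i ∈ S, errCLM t ((u i * b i / √N) • tensorBasis i) =
        -(1 / (√N * n)) * (u i * b i ^ 2) := by
      intro i hi
      rw [map_smul, errCLM_apply, integ_tensorBasis (Finset.ne_of_mem_erase hi), qmc, smul_eq_mul]
      change _ * (0 - 1 / (n : ℝ) * b i) = _
      field_simp
      ring
    rw [Finset.sum_congr rfl this, ← Finset.mul_sum]
    change -(1 / (√N * n)) * N = _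
    have : N = √N * √N := (Real.mul_self_sqrt hN0).symm
    field_simp
    linarith
  have hle : ENNReal.ofReal |errCLM t f| ≤ ENNReal.ofReal ε := by
    refine le_trans ?_ ht
    rw [errCLM_apply]
    exact le_iSup_of_le f (le_iSup_of_le hmem (le_iSup_of_le hnorm le_rfl))
  rw [ENNReal.ofReal_le_ofReal_iff hε, herr, abs_neg, abs_of_nonneg (by positivity),
    div_le_iff₀ hn', Real.sqrt_le_iff] at hle
  nlinarith [hle.2]

lemma one_add_mul_projKernel_nonneg {d : ℕ} {s : ℝ} (hs : 0 ≤ s)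
    (h : s * (4 * 8 ^ d + 4 * 8 ^ d * 2 ^ (2 * d)) ≤ 1) (x y : simplex d) :
    0 ≤ 1 + s * (projKernel d 1 x y + projKernel d 2 x y) := by
  have h1 := (abs_le.1 (abs_projKernel_le (le_refl 1) x y)).1
  have h2 := (abs_le.1 (abs_projKernel_le one_le_two x y)).1
  norm_num at h1 h2
  have : s * -(4 * 8 ^ d + 4 * 8 ^ d * 2 ^ (2 * d)) ≤
      s * (projKernel d 1 x y + projKernel d 2 x y) := by
    gcongr; linarith
  linarith

/-- With `1 / 0 = 0` the empty rule is zero and its error is the initial error. -/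
lemma not_reduces_zero {d : ℕ} {r : ℝ} {γ : (m : ℕ) → Fin m → ℝ} {m : ℕ} (hγ : ∀ j, 0 < γ m j)
    {ε : ℝ} (hε : ε < 1) : ¬ Reduces d r γ ε m 0 := by
  rintro ⟨t, ht⟩
  have : wce r (γ m) t = initErr d r (γ m) := by simp [wce, initErr, qmc]
  rw [this, initErr_eq_one hγ, mul_one, ENNReal.one_le_ofReal] at ht
  linarith

theorem exists_prod_le_minPoints {d : ℕ} (hd : 1 ≤ d) {r : ℝ} (hr : (d : ℝ) + 1 < r)
    {γ : (m : ℕ) → Fin m → ℝ} (hpos : ∀ m j, 0 < γ m j) {Γ : ℝ} (hΓ : ∀ m j, γ m j ≤ Γ) :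
    ∃ η > 0, ∀ m, ∀ ε ∈ Set.Ioo (0 : ℝ) 1,
      ∏ j, (1 + η * γ m j) ≤ 2 * (minPoints d r γ ε m : ℝ) := by
  obtain ⟨κ, hκ, hκle⟩ := exists_pos_le_projKernel hd
  have hr0 : 0 ≤ r := by have : (0 : ℝ) ≤ d := by positivity
                         linarith
  set A : ℝ := (2 * (2 + (d : ℝ))) ^ r with hA
  set B : ℝ := 4 * 8 ^ d + 4 * 8 ^ d * 2 ^ (2 * d) with hB
  have hA0 : 0 < A := by positivity
  have hB0 : 0 < B := by positivity
  -- Meets two demands for all `m` at once: `η A ≤ 1` for domination by the reproducing kernel, `η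
  -- |Γ| B ≤ 1` for pointwise nonnegativity.
  set η : ℝ := 1 / (A + |Γ| * B) with hη
  have hη0 : 0 < η := by positivity
  have hηA : η * A ≤ 1 := by
    rw [hη, one_div_mul_eq_div, div_le_one (by positivity)]
    have : 0 ≤ |Γ| * B := by positivity
    linarith
  have hηB : ∀ m j, η * γ m j * B ≤ 1 := by
    intro m j
    have h1 : γ m j ≤ |Γ| := (hΓ m j).trans (le_abs_self _)
    calc η * γ m j * B ≤ η * |Γ| * B := by gcongr
      _ = |Γ| * B / (A + |Γ| * B) := by rw [hη]; ring
      _ ≤ 1 := by rw [div_le_one (by positivity)]; linarith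
  refine ⟨η * κ, mul_pos hη0 hκ, fun m ε hε => ?_⟩
  have hne : {n | Reduces d r γ ε m n}.Nonempty :=
    ⟨_, reduces_of_le hr (hpos m) hε.1 (Nat.le_ceil _)⟩
  have hred : Reduces d r γ ε m (minPoints d r γ ε m) := Nat.sInf_mem hne
  set n := minPoints d r γ ε m
  have hn : 0 < n := by
    rcases Nat.eq_zero_or_pos n with h | h
    · rw [h] at hred; exact absurd hred (not_reduces_zero (hpos m) hε.2)
    · exact h
  have hn' : (0 : ℝ) < n := by exact_mod_cast hn
  obtain ⟨t, ht⟩ := hred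
  rw [initErr_eq_one (hpos m), mul_one] at ht
  have hup := sum_lowKernel_le hr0 hη0.le (hpos m) hηA hn hε.1.le ht
  have hnn : ∀ x y : Fin m → simplex d, 0 ≤ lowKernel (fun j => η * γ m j) x y := fun x y =>
    Finset.prod_nonneg fun j _ =>
      one_add_mul_projKernel_nonneg (mul_pos hη0 (hpos m j)).le (hηB m j) _ _
  -- Nonnegativity of the kernel allows all off-diagonal pairs to be dropped.
  have hlow : (n : ℝ) * ∏ j, (1 + η * κ * γ m j) ≤
      ∑ a, ∑ b, lowKernel (fun j => η * γ m j) (t a) (t b) := by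
    calc _ = ∑ a : Fin n, ∏ j, (1 + η * κ * γ m j) := by simp
      _ ≤ ∑ a, lowKernel (fun j => η * γ m j) (t a) (t a) := by
          refine Finset.sum_le_sum fun a _ => Finset.prod_le_prod (fun j _ => ?_) fun j _ => ?_
          · have := hpos m j; positivity
          · have := mul_le_mul_of_nonneg_left (hκle (t a j)) (mul_pos hη0 (hpos m j)).le
            linarith
      _ ≤ _ := Finset.sum_le_sum fun a _ =>
          Finset.single_le_sum (f := fun b => lowKernel (fun j => η * γ m j) (t a) (t b))
            (fun b _ => hnn _ _) (Finset.mem_univ a)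
  have hε2 : (1 + ε ^ 2) * (n : ℝ) ^ 2 ≤ 2 * (n : ℝ) ^ 2 := by
    gcongr; nlinarith [hε.1, hε.2]
  have := (hlow.trans hup).trans hε2
  nlinarith

/-! ### Tractability -/

lemma kernelBound_le_exp {d m : ℕ} {r : ℝ} {γ : Fin m → ℝ} (hγ : ∀ j, 0 < γ j) :
    kernelBound d r γ ≤ Real.exp (constC d r * ∑ j, γ j) := by
  rw [Finset.mul_sum, Real.exp_sum]
  refine Finset.prod_le_prod (fun j _ => ?_) fun j _ => ?_
  · have := mul_nonneg (constC_nonneg d r) (hγ j).le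
    linarith
  · rw [add_comm]; exact Real.add_one_le_exp _

lemma minPoints_le_exp {d : ℕ} {r : ℝ} (hr : (d : ℝ) + 1 < r) {γ : (m : ℕ) → Fin m → ℝ} {m : ℕ}
    (hγ : ∀ j, 0 < γ m j) {ε : ℝ} (hε : ε ∈ Set.Ioo (0 : ℝ) 1) :
    (minPoints d r γ ε m : ℝ) ≤ 2 * ε ^ (-2 : ℝ) * Real.exp (constC d r * ∑ j, γ m j) := by
  have := Real.rpow_pos_of_pos hε.1 (-2)
  exact (minPoints_le hr hγ hε).trans
    (mul_le_mul_of_nonneg_left (kernelBound_le_exp hγ) (by positivity))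

lemma exists_exp_le_minPoints {d : ℕ} (hd : 1 ≤ d) {r : ℝ} (hr : (d : ℝ) + 1 < r)
    {γ : (m : ℕ) → Fin m → ℝ} (hpos : ∀ m j, 0 < γ m j) {Γ : ℝ} (hΓ : ∀ m j, γ m j ≤ Γ) :
    ∃ η > 0, ∀ m, ∀ ε ∈ Set.Ioo (0 : ℝ) 1,
      Real.exp (η * ∑ j, γ m j) ≤ 2 * (minPoints d r γ ε m : ℝ) := by
  obtain ⟨η, hη, h⟩ := exists_prod_le_minPoints hd hr hpos hΓ
  refine ⟨η / (1 + η * |Γ|), by positivity, fun m ε hε => le_trans ?_ (h m ε hε)⟩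
  rw [Finset.mul_sum, Real.exp_sum]
  refine Finset.prod_le_prod (fun j _ => (Real.exp_pos _).le) fun j _ => ?_
  have hg := hpos m j
  have hg' : γ m j ≤ |Γ| := (hΓ m j).trans (le_abs_self _)
  have h1 : 0 < 1 + η * γ m j := by positivity
  -- Uses `log(1 + u) ≥ u / (1 + u)` with `u = η γ`, where `u ≤ η |Γ|` in the denominator.
  rw [← Real.le_log_iff_exp_le h1]
  refine le_trans ?_ (Real.one_sub_inv_le_log_of_pos h1)
  calc η / (1 + η * |Γ|) * γ m j ≤ η / (1 + η * γ m j) * γ m j := by gcongr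
    _ = 1 - (1 + η * γ m j)⁻¹ := by field_simp; ring

/-- The finitely many exceptional `m` are absorbed into the constant, since `m ^ q ≥ 1`. -/
lemma exists_polyBound_of_eventually {d : ℕ} {r : ℝ} (hr : (d : ℝ) + 1 < r)
    {γ : (m : ℕ) → Fin m → ℝ} (hpos : ∀ m j, 0 < γ m j) {A q : ℝ} (hA : 0 ≤ A) (hq : 0 ≤ q)
    (h : ∀ᶠ m : ℕ in atTop, 1 ≤ m → Real.exp (constC d r * ∑ j, γ m j) ≤ A * (m : ℝ) ^ q) :
    ∃ C : ℝ, 0 ≤ C ∧ PolyBound d r γ C 2 q := by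
  obtain ⟨M, hM⟩ := eventually_atTop.1 h
  set E : ℕ → ℝ := fun m => Real.exp (constC d r * ∑ j, γ m j) with hE
  have hE0 : ∀ m, 0 ≤ E m := fun m => (Real.exp_pos _).le
  have hS : 0 ≤ ∑ k ∈ Finset.range M, E k := Finset.sum_nonneg fun k _ => hE0 k
  refine ⟨2 * (A + ∑ k ∈ Finset.range M, E k), by positivity, fun m hm ε hε => ?_⟩
  have hm' : (1 : ℝ) ≤ m := by exact_mod_cast hm
  have hmq : 1 ≤ (m : ℝ) ^ q := Real.one_le_rpow hm' hq
  have hEm : E m ≤ (A + ∑ k ∈ Finset.range M, E k) * (m : ℝ) ^ q := by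
    rcases le_or_gt M m with hMm | hMm
    · refine (hM m hMm hm).trans ?_
      gcongr
      linarith
    · have h1 := Finset.single_le_sum (fun k _ => hE0 k) (Finset.mem_range.2 hMm)
      calc E m ≤ (A + ∑ k ∈ Finset.range M, E k) * 1 := by linarith
        _ ≤ _ := by gcongr
  have hε2 := Real.rpow_pos_of_pos hε.1 (-2)
  calc _ ≤ 2 * ε ^ (-2 : ℝ) * E m := minPoints_le_exp hr (hpos m) hε
    _ ≤ 2 * ε ^ (-2 : ℝ) * ((A + ∑ k ∈ Finset.range M, E k) * (m : ℝ) ^ q) := by gcongr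
    _ = _ := by ring

lemma exists_polyBound_zero {d : ℕ} {r : ℝ} (hr : (d : ℝ) + 1 < r)
    {γ : (m : ℕ) → Fin m → ℝ} (hpos : ∀ m j, 0 < γ m j)
    (h : limsup (fun m : ℕ => ((∑ j, γ m j : ℝ) : EReal)) atTop < ⊤) :
    ∃ C : ℝ, 0 ≤ C ∧ PolyBound d r γ C 2 0 := by
  obtain ⟨b, hb, _⟩ := EReal.lt_iff_exists_real_btwn.1 h
  refine exists_polyBound_of_eventually hr hpos (Real.exp_pos (constC d r * b)).le le_rfl ?_
  filter_upwards [eventually_lt_of_limsup_lt hb] with m hm _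
  rw [Real.rpow_zero, mul_one, Real.exp_le_exp]
  exact mul_le_mul_of_nonneg_left (EReal.coe_lt_coe_iff.1 hm).le (constC_nonneg d r)

lemma zero_le_limsup {u : ℕ → ℝ} (hu : ∀ m, 0 ≤ u m) :
    0 ≤ limsup (fun m => (u m : EReal)) atTop :=
  le_limsup_of_frequently_le (Frequently.of_forall fun m => EReal.coe_nonneg.2 (hu m))
    (by isBoundedDefault)

lemma sum_div_log_nonneg {γ : (m : ℕ) → Fin m → ℝ} (hpos : ∀ m j, 0 < γ m j) (m : ℕ) :
    0 ≤ (∑ j, γ m j) / Real.log (m + 1) :=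
  div_nonneg (Finset.sum_nonneg fun j _ => (hpos m j).le)
    (Real.log_nonneg (by have : (0 : ℝ) ≤ m := m.cast_nonneg
                         linarith))

lemma exists_polyBound_of_limsup {d : ℕ} {r : ℝ} (hr : (d : ℝ) + 1 < r)
    {γ : (m : ℕ) → Fin m → ℝ} (hpos : ∀ m j, 0 < γ m j) {β q : ℝ} (hq : constC d r * β < q)
    (h : limsup (fun m : ℕ => (((∑ j, γ m j) / Real.log (m + 1) : ℝ) : EReal)) atTop =
      (β : EReal)) : 0 ≤ q ∧ ∃ C : ℝ, 0 ≤ C ∧ PolyBound d r γ C 2 q := by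
  have hc := constC_nonneg d r
  have hβ : 0 ≤ β := by
    rw [← EReal.coe_nonneg, ← h]
    exact zero_le_limsup (sum_div_log_nonneg hpos)
  have hq0 : 0 ≤ q := (mul_nonneg hc hβ).trans hq.le
  refine ⟨hq0, ?_⟩
  -- A number strictly above the limsup is needed; `q / c_{d,r}` serves unless the constant
  -- vanishes, when any larger number does.
  obtain ⟨β', hβ', hq'⟩ : ∃ β', β < β' ∧ constC d r * β' ≤ q := by
    rcases hc.eq_or_lt with h0 | h0
    · exact ⟨β + 1, by linarith, by rw [← h0, zero_mul]; exact hq0⟩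
    · exact ⟨q / constC d r, by rw [lt_div_iff₀ h0]; linarith,
        (mul_div_cancel₀ q h0.ne').le⟩
  refine exists_polyBound_of_eventually hr hpos (A := 2 ^ q) (by positivity) hq0 ?_
  have hlt : limsup (fun m : ℕ => (((∑ j, γ m j) / Real.log (m + 1) : ℝ) : EReal)) atTop <
      (β' : EReal) := by rw [h]; exact EReal.coe_lt_coe_iff.2 hβ'
  filter_upwards [eventually_lt_of_limsup_lt hlt] with m hm hm1
  have hm1' : (1 : ℝ) ≤ m := by exact_mod_cast hm1
  have hlog : 0 < Real.log (m + 1) := Real.log_pos (by linarith)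
  have hG := (div_lt_iff₀ hlog).1 (EReal.coe_lt_coe_iff.1 hm)
  calc _ ≤ Real.exp (Real.log (m + 1) * q) := by
        rw [Real.exp_le_exp]
        calc _ ≤ constC d r * (β' * Real.log (m + 1)) := by gcongr
          _ = Real.log (m + 1) * (constC d r * β') := by ring
          _ ≤ _ := by gcongr
    _ = ((m : ℝ) + 1) ^ q := by rw [Real.rpow_def_of_pos (by positivity)]
    _ ≤ (2 * (m : ℝ)) ^ q := by gcongr; linarith
    _ = _ := by rw [Real.mul_rpow (by norm_num) (by positivity)]

/-- The lower bound does not involve `ε`, so the fixed value `1 / 2` loses nothing. -/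
lemma exp_le_of_polyBound {d : ℕ} {r η C p q : ℝ} {γ : (m : ℕ) → Fin m → ℝ}
    (hη : ∀ m, ∀ ε ∈ Set.Ioo (0 : ℝ) 1,
      Real.exp (η * ∑ j, γ m j) ≤ 2 * (minPoints d r γ ε m : ℝ))
    (h : PolyBound d r γ C p q) {m : ℕ} (hm : 1 ≤ m) :
    Real.exp (η * ∑ j, γ m j) ≤ 2 * C * (1 / 2) ^ (-p) * (m : ℝ) ^ q := by
  have hε : (1 / 2 : ℝ) ∈ Set.Ioo (0 : ℝ) 1 := by constructor <;> norm_num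
  have h1 := hη m _ hε
  have h2 := h m hm _ hε
  linarith

theorem stronglyPolyTractable_iff {d : ℕ} (hd : 1 ≤ d) {r : ℝ} (hr : (d : ℝ) + 1 < r)
    {γ : (m : ℕ) → Fin m → ℝ} (hpos : ∀ m j, 0 < γ m j) {Γ : ℝ} (hΓ : ∀ m j, γ m j ≤ Γ) :
    StronglyPolyTractable d r γ ↔
      limsup (fun m : ℕ => ((∑ j, γ m j : ℝ) : EReal)) atTop < ⊤ := by
  constructor
  · rintro ⟨C, p, -, -, h⟩
    obtain ⟨η, hη0, hη⟩ := exists_exp_le_minPoints hd hr hpos hΓ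
    set D := 2 * C * (1 / 2 : ℝ) ^ (-p)
    refine lt_of_le_of_lt (limsup_le_of_le (by isBoundedDefault)
      (a := ((Real.log D / η : ℝ) : EReal)) ?_) (EReal.coe_lt_top _)
    filter_upwards [eventually_ge_atTop 1] with m hm
    have h1 := exp_le_of_polyBound hη h hm
    rw [Real.rpow_zero, mul_one] at h1
    rw [EReal.coe_le_coe_iff, le_div_iff₀ hη0, mul_comm]
    exact (Real.le_log_iff_exp_le ((Real.exp_pos _).trans_le h1)).2 h1
  · intro h
    obtain ⟨C, hC, hb⟩ := exists_polyBound_zero hr hpos h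
    exact ⟨C, 2, hC, zero_le_two, hb⟩

theorem strongEpsExponent_le {d : ℕ} {r : ℝ} (hr : (d : ℝ) + 1 < r)
    {γ : (m : ℕ) → Fin m → ℝ} (hpos : ∀ m j, 0 < γ m j)
    (h : limsup (fun m : ℕ => ((∑ j, γ m j : ℝ) : EReal)) atTop < ⊤) :
    strongEpsExponent d r γ ≤ 2 :=
  csInf_le ⟨0, fun _ hp => hp.1⟩ ⟨zero_le_two, exists_polyBound_zero hr hpos h⟩

theorem polyTractable_iff {d : ℕ} (hd : 1 ≤ d) {r : ℝ} (hr : (d : ℝ) + 1 < r)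
    {γ : (m : ℕ) → Fin m → ℝ} (hpos : ∀ m j, 0 < γ m j) {Γ : ℝ} (hΓ : ∀ m j, γ m j ≤ Γ) :
    PolyTractable d r γ ↔
      limsup (fun m : ℕ => (((∑ j, γ m j) / Real.log (m + 1) : ℝ) : EReal)) atTop < ⊤ := by
  constructor
  · rintro ⟨C, p, q, -, -, hq, h⟩
    obtain ⟨η, hη0, hη⟩ := exists_exp_le_minPoints hd hr hpos hΓ
    set D := 2 * C * (1 / 2 : ℝ) ^ (-p)
    -- The constant term `log D` is turned into a multiple of `log (m + 1)` by means of `log (m + 1)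
    -- ≥ log 2`.
    refine lt_of_le_of_lt (limsup_le_of_le (by isBoundedDefault)
      (a := (((|Real.log D| / Real.log 2 + q) / η : ℝ) : EReal)) ?_) (EReal.coe_lt_top _)
    filter_upwards [eventually_ge_atTop 1] with m hm
    have hm' : (1 : ℝ) ≤ m := by exact_mod_cast hm
    have h1 := exp_le_of_polyBound hη h hm
    have hmq : 0 < (m : ℝ) ^ q := by positivity
    have hD : 0 < D := pos_of_mul_pos_left ((Real.exp_pos _).trans_le h1) hmq.le
    have h2 := (Real.le_log_iff_exp_le ((Real.exp_pos _).trans_le h1)).2 h1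
    rw [Real.log_mul hD.ne' hmq.ne', Real.log_rpow (by linarith)] at h2
    have hlog2 : 0 < Real.log 2 := Real.log_pos one_lt_two
    have hlogm : Real.log 2 ≤ Real.log (m + 1) := Real.log_le_log two_pos (by linarith)
    have hlogm' : Real.log m ≤ Real.log (m + 1) := Real.log_le_log (by linarith) (by linarith)
    rw [EReal.coe_le_coe_iff, div_le_div_iff₀ (hlog2.trans_le hlogm) hη0]
    calc (∑ j, γ m j) * η ≤ Real.log D + q * Real.log m := by linarith
      _ ≤ |Real.log D| / Real.log 2 * Real.log 2 + q * Real.log (m + 1) := by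
          rw [div_mul_cancel₀ _ hlog2.ne']
          exact add_le_add (le_abs_self _) (mul_le_mul_of_nonneg_left hlogm' hq)
      _ ≤ |Real.log D| / Real.log 2 * Real.log (m + 1) + q * Real.log (m + 1) := by gcongr
      _ = _ := by ring
  · intro h
    -- Nonnegativity excludes `⊥`, so the limsup is a real number.
    have h0 := zero_le_limsup (sum_div_log_nonneg hpos)
    have hβ := EReal.coe_toReal h.ne (ne_of_gt (lt_of_lt_of_le EReal.bot_lt_zero h0))
    obtain ⟨hq, C, hC, hb⟩ := exists_polyBound_of_limsup hr hpos (lt_add_one _) hβ.symm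
    exact ⟨C, 2, _, hC, zero_le_two, hq, hb⟩

lemma epsExponent_le {d : ℕ} {r : ℝ} (hr : (d : ℝ) + 1 < r)
    {γ : (m : ℕ) → Fin m → ℝ} (hpos : ∀ m j, 0 < γ m j) {β : ℝ}
    (h : limsup (fun m : ℕ => (((∑ j, γ m j) / Real.log (m + 1) : ℝ) : EReal)) atTop =
      (β : EReal)) : epsExponent d r γ ≤ 2 := by
  obtain ⟨hq, C, hC, hb⟩ := exists_polyBound_of_limsup hr hpos (lt_add_one _) h
  exact csInf_le ⟨0, fun _ hp => hp.1⟩ ⟨zero_le_two, C, _, hC, hq, hb⟩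

lemma mExponent_le {d : ℕ} {r : ℝ} (hr : (d : ℝ) + 1 < r)
    {γ : (m : ℕ) → Fin m → ℝ} (hpos : ∀ m j, 0 < γ m j) {β : ℝ}
    (h : limsup (fun m : ℕ => (((∑ j, γ m j) / Real.log (m + 1) : ℝ) : EReal)) atTop =
      (β : EReal)) : mExponent d r γ ≤ constC d r * β := by
  refine le_of_forall_gt_imp_ge_of_dense fun q hq => ?_
  obtain ⟨hq0, C, hC, hb⟩ := exists_polyBound_of_limsup hr hpos hq h
  exact csInf_le ⟨0, fun _ hp => hp.1⟩ ⟨hq0, C, 2, hC, zero_le_two, hb⟩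

lemma tendsto_sum_div_of_weaklyTractable {d : ℕ} (hd : 1 ≤ d) {r : ℝ} (hr : (d : ℝ) + 1 < r)
    {γ : (m : ℕ) → Fin m → ℝ} (hpos : ∀ m j, 0 < γ m j) {Γ : ℝ} (hΓ : ∀ m j, γ m j ≤ Γ)
    (h : WeaklyTractable d r γ) : Tendsto (fun m : ℕ => (∑ j, γ m j) / (m : ℝ)) atTop (𝓝 0) := by
  obtain ⟨η, hη0, hη⟩ := exists_exp_le_minPoints hd hr hpos hΓ
  have hε : (1 / 2 : ℝ) ∈ Set.Ioo (0 : ℝ) 1 := by constructor <;> norm_num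
  have hpath : Tendsto (fun m : ℕ => ((1 / 2 : ℝ), m)) atTop
      (comap (fun z : ℝ × ℕ => z.1⁻¹ + z.2) atTop ⊓
        𝓟 {z | z.1 ∈ Set.Ioo (0 : ℝ) 1 ∧ 1 ≤ z.2}) := by
    refine tendsto_inf.2 ⟨tendsto_comap_iff.2 ?_, tendsto_principal.2 ?_⟩
    · exact tendsto_atTop_add_const_left atTop (1 / 2 : ℝ)⁻¹ tendsto_natCast_atTop_atTop
    · filter_upwards [eventually_ge_atTop 1] with m hm using ⟨hε, hm⟩
  have h1 := (h.comp hpath).abs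
  have h2 : Tendsto (fun m : ℕ => Real.log 2 / (m : ℝ)) atTop (𝓝 0) :=
    tendsto_const_div_atTop_nhds_zero_nat _
  have h3 := (h2.add (h1.const_mul 3)).div_const η
  simp only [abs_zero, mul_zero, add_zero, zero_div] at h3
  refine squeeze_zero' (.of_forall fun m => div_nonneg
    (Finset.sum_nonneg fun j _ => (hpos m j).le) m.cast_nonneg) ?_ h3
  filter_upwards [eventually_ge_atTop 1] with m hm
  have hm' : (1 : ℝ) ≤ m := by exact_mod_cast hm
  have h4 := hη m _ hε
  have hN : (0 : ℝ) < minPoints d r γ (1 / 2) m := by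
    have := (Real.exp_pos _).trans_le h4
    linarith
  have h5 := (Real.le_log_iff_exp_le (by positivity)).2 h4
  rw [Real.log_mul two_ne_zero hN.ne'] at h5
  set L := Real.log (minPoints d r γ (1 / 2) m)
  have hL : 0 ≤ L := Real.log_natCast_nonneg _
  -- Since `m ≥ 1`, the denominator `2 + m` is at most `3 m`.
  have hL2 : L / m ≤ 3 * (L / ((1 / 2 : ℝ)⁻¹ + m)) := by
    rw [mul_div_assoc', div_le_div_iff₀ (by linarith) (by norm_num; linarith)]
    norm_num
    nlinarith
  simp only [Function.comp_apply]
  rw [le_div_iff₀ hη0]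
  calc (∑ j, γ m j) / m * η = (η * ∑ j, γ m j) / m := by ring
    _ ≤ (Real.log 2 + L) / m := by gcongr
    _ = Real.log 2 / m + L / m := add_div _ _ _
    _ ≤ _ := by
      gcongr
      exact hL2.trans (mul_le_mul_of_nonneg_left (le_abs_self _) (by norm_num))

/-- Along `l` the index `m` need not tend to infinity. Where `m` is large, `G m ≤ δ m / 2 ≤ δ w`;
the finitely many other values of `G` are bounded while `w` tends to infinity. -/
lemma tendsto_div_of_tendsto_div_natCast {G : ℕ → ℝ} (hG : ∀ m, 0 ≤ G m)
    (h : Tendsto (fun m : ℕ => G m / (m : ℝ)) atTop (𝓝 0)) {l : Filter (ℝ × ℕ)} {w : ℝ × ℕ → ℝ}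
    (hw : Tendsto w l atTop) (hle : ∀ᶠ z in l, (z.2 : ℝ) ≤ w z) :
    Tendsto (fun z => G z.2 / w z) l (𝓝 0) := by
  have key : ∀ δ > 0, ∀ᶠ z in l, G z.2 / w z ≤ δ := by
    intro δ hδ
    obtain ⟨M, hM⟩ := eventually_atTop.1
      ((h.eventually (gt_mem_nhds (half_pos hδ))).and (eventually_ge_atTop 1))
    set S := ∑ k ∈ Finset.range M, G k
    have hS : 0 ≤ S := Finset.sum_nonneg fun k _ => hG k
    filter_upwards [hle, hw.eventually_ge_atTop (S / (δ / 2)), hw.eventually_gt_atTop 0]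
      with z hz hz1 hz0
    rw [div_le_iff₀ hz0]
    rw [div_le_iff₀ (half_pos hδ)] at hz1
    rcases le_or_gt M z.2 with hMz | hMz
    · obtain ⟨h1, h2⟩ := hM z.2 hMz
      have h2' : (0 : ℝ) < z.2 := by exact_mod_cast h2
      rw [div_lt_iff₀ h2'] at h1
      nlinarith
    · have := Finset.single_le_sum (fun k _ => hG k) (Finset.mem_range.2 hMz)
      nlinarith
  refine Metric.tendsto_nhds.2 fun δ hδ => ?_
  filter_upwards [key (δ / 2) (half_pos hδ), hw.eventually_gt_atTop 0] with z hz hz0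
  rw [Real.dist_0_eq_abs, abs_of_nonneg (div_nonneg (hG _) hz0.le)]
  linarith

lemma weaklyTractable_of_tendsto {d : ℕ} {r : ℝ} (hr : (d : ℝ) + 1 < r)
    {γ : (m : ℕ) → Fin m → ℝ} (hpos : ∀ m j, 0 < γ m j)
    (h : Tendsto (fun m : ℕ => (∑ j, γ m j) / (m : ℝ)) atTop (𝓝 0)) : WeaklyTractable d r γ := by
  unfold WeaklyTractable
  set l := comap (fun z : ℝ × ℕ => z.1⁻¹ + z.2) atTop ⊓
    𝓟 {z | z.1 ∈ Set.Ioo (0 : ℝ) 1 ∧ 1 ≤ z.2} with hl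
  have hw : Tendsto (fun z : ℝ × ℕ => z.1⁻¹ + z.2) l atTop :=
    tendsto_comap.mono_left inf_le_left
  have hmem : ∀ᶠ z in l, z.1 ∈ Set.Ioo (0 : ℝ) 1 ∧ 1 ≤ z.2 :=
    mem_of_superset (mem_inf_of_right (mem_principal_self _)) fun _ hz => hz
  have hG := tendsto_div_of_tendsto_div_natCast
    (fun m => Finset.sum_nonneg fun j _ => (hpos m j).le) h hw (by
      filter_upwards [hmem] with z hz
      have := inv_pos.2 hz.1.1
      linarith)
  have h1 : Tendsto (fun z : ℝ × ℕ => Real.log 2 / (z.1⁻¹ + z.2)) l (𝓝 0) :=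
    hw.const_div_atTop _
  have h2 : Tendsto (fun z : ℝ × ℕ => Real.log (z.1⁻¹ + z.2) / (z.1⁻¹ + z.2)) l (𝓝 0) :=
    (Real.isLittleO_log_id_atTop.tendsto_div_nhds_zero).comp hw
  have h3 := (h1.add (h2.const_mul 2)).add (hG.const_mul (constC d r))
  simp only [mul_zero, add_zero] at h3
  refine squeeze_zero' ?_ ?_ h3
  · filter_upwards [hw.eventually_gt_atTop 0] with z hz
    exact div_nonneg (Real.log_natCast_nonneg _) hz.le
  · filter_upwards [hw.eventually_gt_atTop 0, hmem] with z hz hz2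
    obtain ⟨hε, hm⟩ := hz2
    have hεi := inv_pos.2 hε.1
    -- The `ε` part costs only `2 log(1/ε)`, which is negligible against `1/ε + m`.
    have hlog : Real.log (minPoints d r γ z.1 z.2) ≤
        Real.log 2 + 2 * Real.log (z.1⁻¹ + z.2) + constC d r * ∑ j, γ z.2 j := by
      have hle : Real.log z.1⁻¹ ≤ Real.log (z.1⁻¹ + z.2) :=
        Real.log_le_log hεi (le_add_of_nonneg_right (Nat.cast_nonneg _))
      have hεp := Real.rpow_pos_of_pos hε.1 (-2)
      have hub := minPoints_le_exp hr (hpos z.2) hε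
      have hubpos : 0 < 2 * z.1 ^ (-2 : ℝ) * Real.exp (constC d r * ∑ j, γ z.2 j) := by positivity
      have hlogub : Real.log (2 * z.1 ^ (-2 : ℝ) * Real.exp (constC d r * ∑ j, γ z.2 j)) =
          Real.log 2 + 2 * Real.log z.1⁻¹ + constC d r * ∑ j, γ z.2 j := by
        rw [Real.log_mul (by positivity) (Real.exp_ne_zero _), Real.log_mul two_ne_zero hεp.ne',
          Real.log_exp, Real.log_rpow hε.1, Real.log_inv]
        ring
      rcases Nat.eq_zero_or_pos (minPoints d r γ z.1 z.2) with h0 | h0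
      · rw [h0, Nat.cast_zero, Real.log_zero]
        have hm' : (1 : ℝ) ≤ z.2 := by exact_mod_cast hm
        have := Real.log_nonneg one_le_two
        have := Real.log_nonneg (show (1 : ℝ) ≤ z.1⁻¹ + z.2 by linarith)
        have := mul_nonneg (constC_nonneg d r)
          (Finset.sum_nonneg fun j (_ : j ∈ Finset.univ) => (hpos z.2 j).le)
        positivity
      · have := Real.log_le_log (by exact_mod_cast h0) hub
        rw [hlogub] at this
        linarith
    calc _ ≤ (Real.log 2 + 2 * Real.log (z.1⁻¹ + z.2) + constC d r * ∑ j, γ z.2 j) /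
          (z.1⁻¹ + z.2) := by gcongr
      _ = _ := by ring

end SimplexQMC

end

open SimplexQMC in
theorem mainTheorem1 (d : ℕ) (hd : 1 ≤ d) (r : ℝ) (hr : (d : ℝ) + 1 < r)
    (γ : (m : ℕ) → Fin m → ℝ) (hpos : ∀ m j, 0 < γ m j)
    (hbdd : ∃ Γ : ℝ, ∀ m j, γ m j ≤ Γ) :
    -- the constants `M` and `c_{d,r}` are finite, and `n(ε, m)` is well defined
    BddAbove (kernelRatios d) ∧ Summable (cTerm d r) ∧
    (∀ m : ℕ, 1 ≤ m → ∀ ε ∈ Set.Ioo (0 : ℝ) 1, ∃ n, Reduces d r γ ε m n) ∧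
    -- (1)
    (StronglyPolyTractable d r γ ↔
      limsup (fun m : ℕ => ((∑ j, γ m j : ℝ) : EReal)) atTop < ⊤) ∧
    (limsup (fun m : ℕ => ((∑ j, γ m j : ℝ) : EReal)) atTop < ⊤ →
      strongEpsExponent d r γ ≤ 2) ∧
    -- (2)
    (PolyTractable d r γ ↔
      limsup (fun m : ℕ => (((∑ j, γ m j) / Real.log (m + 1) : ℝ) : EReal)) atTop < ⊤) ∧
    (∀ β : ℝ,
      limsup (fun m : ℕ => (((∑ j, γ m j) / Real.log (m + 1) : ℝ) : EReal)) atTop = (β : EReal) →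
        epsExponent d r γ ≤ 2 ∧ mExponent d r γ ≤ constC d r * β ∧
        ∀ q : ℝ, constC d r * β < q → ∃ C : ℝ, 0 ≤ C ∧ PolyBound d r γ C 2 q) ∧
    -- (3)
    (WeaklyTractable d r γ ↔
      Tendsto (fun m : ℕ => (∑ j, γ m j) / (m : ℝ)) atTop (𝓝 0)) := by
  obtain ⟨Γ, hΓ⟩ := hbdd
  exact ⟨bddAbove_kernelRatios d, summable_cTerm hr,
    fun m _ ε hε => ⟨_, reduces_of_le hr (hpos m) hε.1 (Nat.le_ceil _)⟩,
    stronglyPolyTractable_iff hd hr hpos hΓ, strongEpsExponent_le hr hpos,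
    polyTractable_iff hd hr hpos hΓ,
    fun β hβ => ⟨epsExponent_le hr hpos hβ, mExponent_le hr hpos hβ,
      fun q hq => (exists_polyBound_of_limsup hr hpos hq hβ).2⟩,
    tendsto_sum_div_of_weaklyTractable hd hr hpos hΓ, weaklyTractable_of_tendsto hr hpos⟩
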